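/- Let $N\ge 3$ and let $D\subset\mathbb S^{N-1}$ be a smooth domain (nonempty, connected, relatively open, with smooth relative boundary, possibly empty, on one side of which it lies locally). Let $\Sigma_D=\{sq:\ q\in D,\ s>0\}$ be the cone spanned by $D$, $S_D=\{sq:\ q\in D,\ 0<s<1\}$ the spherical sector, and $\Gamma_1=\partial\Sigma_D\cap\partial S_D$. Let $H=H^1_0(S_D\cup\Gamma_1)$ be the completion of $C^1_c(S_D\cup\Gamma_1)$ in the $H^1$ norm. Let $a\in L^\infty(S_D)$ be radial and, for $v\in H$, put $$Q_a(v)=\int_{S_D}\bigl(|\nabla v|^2-a\,v^2\bigr)\,dx ,$$ the quadratic form of $L_a=-\Delta-a$. The eigenvalues of $L_a$ and the singular eigenvalues are defined iteratively, for $i=1,2,\dots$, by $$\Lambda_i=\inf\left\{\frac{Q_a(v)}{\int_{S_D}v^2\,dx}:\ v\in H\setminus\{0\},\ \int_{S_D}v\,\psi_j\,dx=0\ \text{ for } 1\le j<i\right\},$$ $$\hat\Lambda_i=\inf\left\{\frac{Q_a(v)}{\int_{S_D}|x|^{-2}v^2\,dx}:\ v\in H\setminus\{0\},\ \int_{S_D}|x|^{-2}v\,\hat\psi_j\,dx=0\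 \text{ for } 1\le j<i\right\},$$ where $\psi_j\in H$ is any function attaining the infimum $\Lambda_j$, and, as long as $\hat\Lambda_j<0$, $\hat\psi_j\in H$ is any function attaining the infimum $\hat\Lambda_j$. (Attainment is not an assumption: if there were no minimiser at some step, any element of $H$ may be taken there. The iteration for $\hat\Lambda_i$ is only relevant up to the first $i$ with $\hat\Lambda_i\ge 0$; $\hat\psi_j\in H$ may be taken arbitrary from there on, and the later $\hat\Lambda_i$ are then nonnegative as well.) Let $$k_a=\#\{i\ge 1:\ \Lambda_i<0\},\qquad \hat k_a=\#\{i\ge 1:\ \hat\Lambda_i<0\}.$$ Then, whatever the choices of the $\psi_j$ and $\hat\psi_j$, $k_a=\hat k_a$. -/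

import Mathlib

open MeasureTheory Set Topology
open scoped ContDiff ENNReal

noncomputable section

namespace SphericalSector

/-- Euclidean space `ℝ^N`. -/
abbrev Space (N : ℕ) : Type := EuclideanSpace ℝ (Fin N)

variable {N : ℕ}

/-- `D` is a smooth domain of the unit sphere: nonempty, connected, relatively open, and lying locally
on one side of its smooth relative boundary. Since `D` is relatively open in the closed
set `𝕊^{N-1}`, its relative boundary is `closure D \ D`. The last clause of `smooth_boundary` says that
the differential at `p` of the restriction of `ρ` to the sphere is nonzero. -/
structure IsSmoothDomain (D : Set (Space N)) : Prop where
  relatively_open : ∃ U : Set (Space N), IsOpen U ∧ D = Metric.sphere 0 1 ∩ U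
  connected : IsConnected D
  smooth_boundary : ∀ p ∈ closure D \ D, ∃ U ∈ 𝓝 p, ∃ ρ : Space N → ℝ,
    ContDiff ℝ ∞ ρ ∧
    D ∩ U = {q | q ∈ Metric.sphere (0 : Space N) 1 ∩ U ∧ ρ q < 0} ∧
    ∃ τ : Space N, inner ℝ p τ = 0 ∧ fderiv ℝ ρ p τ ≠ 0

/-- The cone `Σ_D` spanned by `D`. -/
def cone (D : Set (Space N)) : Set (Space N) :=
  {x | ∃ q ∈ D, ∃ s : ℝ, 0 < s ∧ x = s • q}

/-- The spherical sector `S_D`. -/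
def sector (D : Set (Space N)) : Set (Space N) :=
  {x | ∃ q ∈ D, ∃ s : ℝ, 0 < s ∧ s < 1 ∧ x = s • q}

/-- The part `Γ₁ = ∂Σ_D ∩ ∂S_D` of the boundary of the sector. -/
def lateralBoundary (D : Set (Space N)) : Set (Space N) :=
  frontier (cone D) ∩ frontier (sector D)

/-- Lebesgue measure on `S_D`. -/
abbrev sectorMeasure (D : Set (Space N)) : Measure (Space N) :=
  volume.restrict (sector D)

/-- `φ` (or rather its restriction to `S_D ∪ Γ₁`) belongs to `C¹_c(S_D ∪ Γ₁)`: it is `C¹` up to the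
boundary, and its support in `closure S_D` is a compact subset of `S_D ∪ Γ₁`. -/
structure IsTestFunction (D : Set (Space N)) (φ : Space N → ℝ) : Prop where
  contDiff : ContDiff ℝ 1 φ
  hasCompactSupport : HasCompactSupport φ
  support_subset : tsupport φ ∩ closure (sector D) ⊆ sector D ∪ lateralBoundary D

/-- Pairs (function, gradient field) in `L²(S_D) × L²(S_D; ℝ^N)`, with the `H¹` norm
`(‖v‖² + ‖∇v‖²)^{1/2}`. -/
abbrev PairSpace (D : Set (Space N)) : Type :=
  WithLp 2 (Lp ℝ 2 (sectorMeasure D) × Lp (Space N) 2 (sectorMeasure D))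

/-- The pairs `(φ, ∇φ)` with `φ ∈ C¹_c(S_D ∪ Γ₁)`. -/
def testPairs (D : Set (Space N)) : Set (PairSpace D) :=
  {p | ∃ φ : Space N → ℝ, IsTestFunction D φ ∧
    p.fst =ᵐ[sectorMeasure D] φ ∧ p.snd =ᵐ[sectorMeasure D] gradient φ}

/-- The Sobolev space `H¹₀(S_D ∪ Γ₁)`: the completion of `C¹_c(S_D ∪ Γ₁)` for the `H¹` norm, realised
as the closure of `{(φ, ∇φ)}` in the complete space `L²(S_D) × L²(S_D; ℝ^N)`. (The set `testPairs D` is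
already a linear subspace, so taking its span does not enlarge it.) -/
def H10 (D : Set (Space N)) : Submodule ℝ (PairSpace D) :=
  (Submodule.span ℝ (testPairs D)).topologicalClosure

/-- The function `v`, as a function on `S_D`. -/
def value {D : Set (Space N)} (v : H10 D) : Space N → ℝ := v.1.fst

/-- The weak gradient `∇v`. -/
def grad {D : Set (Space N)} (v : H10 D) : Space N → Space N := v.1.snd

/-- `a` is a radial function in `L^∞(S_D)`. -/
structure IsRadialBounded (D : Set (Space N)) (a : Space N → ℝ) : Prop where
  memLp : MemLp a ∞ (sectorMeasure D)
  radial : ∃ g : ℝ → ℝ, ∀ᵐ x ∂(sectorMeasure D), a x = g ‖x‖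

/-- The quadratic form `Q_a(v) = ∫_{S_D} (|∇v|² - a v²) dx` of `L_a = -Δ - a`. -/
def energy {D : Set (Space N)} (a : Space N → ℝ) (v : H10 D) : ℝ :=
  ∫ x in sector D, (‖grad v x‖ ^ 2 - a x * value v x ^ 2)

/-- The weighted `L²` pairing `∫_{S_D} w u v dx`. -/
def pairing {D : Set (Space N)} (w : Space N → ℝ) (u v : H10 D) : ℝ :=
  ∫ x in sector D, w x * (value u x * value v x)

/-- The nonzero `v ∈ H¹₀(S_D ∪ Γ₁)` orthogonal, for the weight `w`, to `ψ 0, …, ψ (i-1)`. -/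
def admissible {D : Set (Space N)} (w : Space N → ℝ) (ψ : ℕ → H10 D) (i : ℕ) : Set (H10 D) :=
  {v | v ≠ 0 ∧ ∀ j < i, pairing w v (ψ j) = 0}

/-- `Q_a(v) / ∫_{S_D} w v² dx`. -/
def rayleigh {D : Set (Space N)} (a w : Space N → ℝ) (v : H10 D) : ℝ :=
  energy a v / pairing w v v

/-- The infimum of the Rayleigh quotient for the weight `w` over the functions orthogonal to
`ψ 0, …, ψ (i-1)`. Indices start at `0`. -/
def eigenvalue {D : Set (Space N)} (a w : Space N → ℝ) (ψ : ℕ → H10 D) (i : ℕ) : ℝ :=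
  sInf (rayleigh a w '' admissible w ψ i)

/-- `v` is a function at which the infimum `eigenvalue a w ψ i` is attained. -/
def Attains {D : Set (Space N)} (a w : Space N → ℝ) (ψ : ℕ → H10 D) (i : ℕ) (v : H10 D) : Prop :=
  v ∈ admissible w ψ i ∧ rayleigh a w v = eigenvalue a w ψ i

/-- The weight `1` of the ordinary eigenvalue problem. -/
def unitWeight : Space N → ℝ := fun _ => 1

/-- The weight `|x|⁻²` of the singular eigenvalue problem. -/
def singularWeight : Space N → ℝ := fun x => (‖x‖ ^ 2)⁻¹

/-- The ordinary eigenvalue `Λ_{i+1}`, relative to the eigenfunctions `ψ`. -/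
def ordinaryEigenvalue {D : Set (Space N)} (a : Space N → ℝ) (ψ : ℕ → H10 D) (i : ℕ) : ℝ :=
  eigenvalue a unitWeight ψ i

/-- The singular eigenvalue `Λ̂_{i+1}`, relative to the eigenfunctions `ψ`. -/
def singularEigenvalue {D : Set (Space N)} (a : Space N → ℝ) (ψ : ℕ → H10 D) (i : ℕ) : ℝ :=
  eigenvalue a singularWeight ψ i

/-- `ψ` results from the iteration that defines the `Λ_i`: at every step, `ψ i` is a function attaining
the infimum, chosen arbitrarily among all of them. That the infimum is attained is not assumed
here: the condition at step `i` asks nothing if there is no minimiser. -/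
def IsEigenfunctionSequence {D : Set (Space N)} (a : Space N → ℝ) (ψ : ℕ → H10 D) : Prop :=
  ∀ i, (∃ v, Attains a unitWeight ψ i v) → Attains a unitWeight ψ i (ψ i)

/-- `ψ` results from the iteration that defines the `Λ̂_i`: as long as the infimum is negative, `ψ i` is
a function attaining it, chosen arbitrarily. Again, attainment is not assumed. Once some `Λ̂_i ≥ 0`
the iteration stops; the later `ψ j` are then irrelevant, since the infima increase with the
index and stay nonnegative. -/
def IsSingularEigenfunctionSequence {D : Set (Space N)} (a : Space N → ℝ) (ψ : ℕ → H10 D) : Prop :=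
  ∀ i, singularEigenvalue a ψ i < 0 →
    (∃ v, Attains a singularWeight ψ i v) → Attains a singularWeight ψ i (ψ i)

/-- The admissible functions at step `i` depend only on the earlier `ψ j`. -/
theorem admissible_congr {D : Set (Space N)} (w : Space N → ℝ) {ψ φ : ℕ → H10 D} {i : ℕ}
    (h : ∀ j < i, ψ j = φ j) : admissible w ψ i = admissible w φ i := by
  ext v
  simp only [admissible, mem_ofPred_eq]
  refine and_congr_right fun _ => forall₂_congr fun j hj => ?_
  rw [h j hj]

/-- For every weight, the iteration can be carried out. -/
theorem exists_iteration {D : Set (Space N)} (a w : Space N → ℝ) :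
    ∃ ψ : ℕ → H10 D, ∀ i, (∃ v, Attains a w ψ i v) → Attains a w ψ i (ψ i) := by
  classical
  let step : (i : ℕ) → ((j : ℕ) → j < i → H10 D) → H10 D := fun i f =>
    if h : ∃ v, Attains a w (fun j => if hj : j < i then f j hj else 0) i v then h.choose else 0
  let ψ : ℕ → H10 D := fun i => Nat.strongRec step i
  have hψ : ∀ i, ψ i = step i (fun j _ => ψ j) := fun i => by
    simp only [ψ]
    rw [Nat.strongRec]
  refine ⟨ψ, fun i hi => ?_⟩
  have key : ∀ v, Attains a w (fun j => if j < i then ψ j else 0) i v ↔ Attains a w ψ i v := by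
    intro v
    have e : admissible w (fun j => if j < i then ψ j else 0) i = admissible w ψ i :=
      admissible_congr w fun j hj => by simp [hj]
    simp only [Attains, eigenvalue, e]
  have hi' : ∃ v, Attains a w (fun j => if j < i then ψ j else 0) i v :=
    hi.imp fun v hv => (key v).2 hv
  have hs : ψ i = hi'.choose := by
    rw [hψ i]
    simp only [step, dite_eq_ite]
    rw [dif_pos hi']
  rw [← key, hs]
  exact hi'.choose_spec

theorem exists_isEigenfunctionSequence (D : Set (Space N)) (a : Space N → ℝ) :
    ∃ ψ : ℕ → H10 D, IsEigenfunctionSequence a ψ :=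
  exists_iteration a unitWeight

theorem exists_isSingularEigenfunctionSequence (D : Set (Space N)) (a : Space N → ℝ) :
    ∃ ψ : ℕ → H10 D, IsSingularEigenfunctionSequence a ψ :=
  (exists_iteration a singularWeight).imp fun _ h i _ => h i

end SphericalSector

end

/-! Both counts equal the negative index of `Q_a`, the largest dimension of a subspace of `H` on
which `Q_a` is negative definite, and that number does not involve the weight. If the levels `0, …,
i` for one weight are negative, they are attained, and their minimisers are `Q_a`-orthogonal with
negative energy, so they span a negative space of dimension `i + 1` (`exists_negative_space`). For
the other weight, `i` orthogonality constraints leave a nonzero vector in that space, which makes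
its level `i` negative (`level_neg_of_negative_space`). Hence the two sets of indices coincide, not
only their cardinalities.

The analytic point is attainment (`exists_isMinimizer`). At a level `Λ < 0` the term `-Λ w` is
nonnegative, so `q - Λ w` stays coercive up to the `L²` norm. Compactness is then needed only for
the embedding in `L²`, never for the weight; this is what admits `|x|⁻²`.

Two facts about the sector remain. Hardy's inequality (`IsSmoothDomain.hardy`), by integration along
rays to the spherical cap where test functions vanish, makes the singular pairing bounded on `H`.
The compact embedding (`IsSmoothDomain.inclusion_compact`) uses Hardy near the vertex; elsewhere the
sector can be shifted locally into itself, so functions can be compared with averages over small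
balls inside the sector. -/

open MeasureTheory Set Topology Filter
open scoped ContDiff ENNReal

noncomputable section

/-! ### Iterated minimisation and the negative index of a quadratic form -/

namespace NegativeIndex

variable {H L : Type*} [NormedAddCommGroup H] [InnerProductSpace ℝ H]
  [NormedAddCommGroup L] [NormedSpace ℝ L]

/-- The nonzero vectors orthogonal to `ψ 0, …, ψ (i-1)` for the bilinear form `w`. -/
def constrained (w : H →L[ℝ] H →L[ℝ] ℝ) (ψ : ℕ → H) (i : ℕ) : Set H :=
  {v | v ≠ 0 ∧ ∀ j < i, w v (ψ j) = 0}

/-- The infimum of `q(v) / w(v)` over the vectors orthogonal to `ψ 0, …, ψ (i-1)`. -/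
def level (q w : H →L[ℝ] H →L[ℝ] ℝ) (ψ : ℕ → H) (i : ℕ) : ℝ :=
  sInf ((fun v => q v v / w v v) '' constrained w ψ i)

/-- `v` attains the infimum `level q w ψ i`. -/
def IsMinimizer (q w : H →L[ℝ] H →L[ℝ] ℝ) (ψ : ℕ → H) (i : ℕ) (v : H) : Prop :=
  v ∈ constrained w ψ i ∧ q v v / w v v = level q w ψ i

/-- A symmetric form `q` that is coercive up to the compact map `J`, and a positive symmetric
weight `w` dominating `J`. -/
structure Admissible (J : H →L[ℝ] L) (q w : H →L[ℝ] H →L[ℝ] ℝ) : Prop where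
  q_symm : ∀ u v, q u v = q v u
  w_symm : ∀ u v, w u v = w v u
  coercive : ∃ C : ℝ, 0 ≤ C ∧ ∀ v, ‖v‖ ^ 2 - C * ‖J v‖ ^ 2 ≤ q v v
  dominates : ∀ v, ‖J v‖ ^ 2 ≤ w v v
  compact : ∀ v : ℕ → H, (∀ n, ‖v n‖ ≤ 1) →
    ∃ φ : ℕ → ℕ, StrictMono φ ∧ CauchySeq fun n => J (v (φ n))

variable {J : H →L[ℝ] L} {q w : H →L[ℝ] H →L[ℝ] ℝ} {ψ : ℕ → H}

namespace Admissible

lemma w_nonneg (h : Admissible J q w) (v : H) : 0 ≤ w v v :=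
  (sq_nonneg _).trans (h.dominates v)

/-- Since `w` dominates `J`, a null vector of `w` is killed by `J`, and there coercivity is
unconditional. This controls the vectors at which the quotient takes the default value `0`. -/
lemma q_pos_of_w_eq_zero (h : Admissible J q w) {v : H} (hv : v ≠ 0) (h0 : w v v = 0) :
    0 < q v v := by
  obtain ⟨C, -, hC⟩ := h.coercive
  have h1 := h.dominates v
  have h2 : ‖J v‖ ^ 2 = 0 := le_antisymm (h0 ▸ h1) (sq_nonneg _)
  have h3 := hC v
  have : 0 < ‖v‖ := norm_pos_iff.2 hv
  rw [h2] at h3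
  nlinarith

lemma bddBelow (h : Admissible J q w) (i : ℕ) :
    BddBelow ((fun v => q v v / w v v) '' constrained w ψ i) := by
  obtain ⟨C, hC0, hC⟩ := h.coercive
  refine ⟨-C, ?_⟩
  rintro _ ⟨v, -, rfl⟩
  rcases (h.w_nonneg v).eq_or_lt with h0 | h0
  · simp [← h0, hC0]
  · simp only
    rw [le_div_iff₀ h0]
    have h1 := hC v
    have h2 := mul_le_mul_of_nonneg_left (h.dominates v) hC0
    nlinarith [sq_nonneg ‖v‖]

lemma level_mul_le (h : Admissible J q w) {i : ℕ} {v : H} (hv : ∀ j < i, w v (ψ j) = 0) :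
    level q w ψ i * w v v ≤ q v v := by
  by_cases hv0 : v = 0
  · simp [hv0]
  rcases (h.w_nonneg v).eq_or_lt with h0 | h0
  · rw [← h0, mul_zero]
    exact (h.q_pos_of_w_eq_zero hv0 h0.symm).le
  · rw [← le_div_iff₀ h0]
    exact csInf_le (h.bddBelow i) ⟨v, ⟨hv0, hv⟩, rfl⟩

/-- The infimum of the empty set is `0` by convention, so exhausted constraints never produce a
negative level. -/
lemma nonempty_of_level_neg {i : ℕ} (hi : level q w ψ i < 0) :
    ((fun v => q v v / w v v) '' constrained w ψ i).Nonempty := by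
  by_contra hne
  rw [Set.not_nonempty_iff_eq_empty] at hne
  simp [level, hne] at hi

lemma level_neg_of_le (h : Admissible J q w) {i j : ℕ} (hij : i ≤ j)
    (hj : level q w ψ j < 0) : level q w ψ i < 0 := by
  refine lt_of_le_of_lt ?_ hj
  refine csInf_le_csInf (h.bddBelow i) (nonempty_of_level_neg hj) (image_mono ?_)
  exact fun v hv => ⟨hv.1, fun k hk => hv.2 k (hk.trans_le hij)⟩

/-- Negative levels are attained. -/
theorem exists_isMinimizer [CompleteSpace H] (h : Admissible J q w) {i : ℕ}
    (hi : level q w ψ i < 0) : ∃ v, IsMinimizer q w ψ i v := by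
  obtain ⟨C, hC0, hC⟩ := h.coercive
  set Λ := level q w ψ i with hΛ
  let F : H → ℝ := fun v => q v v - Λ * w v v
  have hF0 : ∀ v, (∀ j < i, w v (ψ j) = 0) → 0 ≤ F v := fun v hv =>
    sub_nonneg.2 (h.level_mul_le hv)
  -- The sign of `Λ` enters here: `-Λ w` only helps coercivity.
  have hFC : ∀ v, ‖v‖ ^ 2 - C * ‖J v‖ ^ 2 ≤ F v := fun v => by
    have := hC v
    have := mul_nonneg (neg_nonneg.2 hi.le) (h.w_nonneg v)
    simp only [F]; linarith
  have hseq : ∀ n : ℕ, ∃ v : H, ‖v‖ = 1 ∧ (∀ j < i, w v (ψ j) = 0) ∧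
      F v ≤ ‖w‖ * (1 / ((n : ℝ) + 1)) := by
    intro n
    have hε : (0 : ℝ) < 1 / ((n : ℝ) + 1) := by positivity
    -- The minimum with `0` forces a negative quotient, which excludes `w u u = 0`.
    have hlt : Λ < min 0 (Λ + 1 / ((n : ℝ) + 1)) := lt_min hi (by linarith)
    obtain ⟨_, ⟨u, ⟨hu0, hu⟩, rfl⟩, hlt'⟩ :=
      exists_lt_of_csInf_lt (nonempty_of_level_neg hi) hlt
    obtain ⟨hneg, hlt2⟩ := lt_min_iff.1 hlt'
    have hwpos : 0 < w u u := by
      refine lt_of_le_of_ne (h.w_nonneg u) fun h0 => ?_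
      simp [← h0] at hneg
    rw [div_lt_iff₀ hwpos] at hlt2
    have hnu : 0 < ‖u‖ := norm_pos_iff.2 hu0
    have hw1 : ∀ v : H, ‖v‖ = 1 → w v v ≤ ‖w‖ := fun v hv => by
      have := w.le_opNorm₂ v v
      rw [hv, mul_one, mul_one] at this
      exact (le_abs_self _).trans this
    have hn1 : ‖‖u‖⁻¹ • u‖ = 1 := by
      rw [norm_smul, norm_inv, norm_norm, inv_mul_cancel₀ hnu.ne']
    refine ⟨‖u‖⁻¹ • u, hn1, fun j hj => by simp [hu j hj], ?_⟩
    have e : F (‖u‖⁻¹ • u) = ‖u‖⁻¹ * (‖u‖⁻¹ * F u) := by simp [F]; ring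
    have e' : w (‖u‖⁻¹ • u) (‖u‖⁻¹ • u) = ‖u‖⁻¹ * (‖u‖⁻¹ * w u u) := by simp
    have h1 := hw1 _ hn1
    rw [e'] at h1
    rw [e]
    have hFu : F u ≤ w u u * (1 / ((n : ℝ) + 1)) := by simp only [F]; linarith
    calc ‖u‖⁻¹ * (‖u‖⁻¹ * F u) ≤ ‖u‖⁻¹ * (‖u‖⁻¹ * (w u u * (1 / ((n : ℝ) + 1)))) := by gcongr
      _ = (‖u‖⁻¹ * (‖u‖⁻¹ * w u u)) * (1 / ((n : ℝ) + 1)) := by ring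
      _ ≤ _ := by gcongr
  choose v hv1 hvW hvF using hseq
  obtain ⟨φ, hφ, hJ⟩ := h.compact v fun n => (hv1 n).le
  have hFt : Tendsto (fun n => F (v (φ n))) atTop (𝓝 0) := by
    refine squeeze_zero (fun n => hF0 _ (hvW _)) (fun n => hvF (φ n)) ?_
    have := (tendsto_one_div_add_atTop_nhds_zero_nat (𝕜 := ℝ)).const_mul ‖w‖
    rw [mul_zero] at this
    exact this.comp hφ.tendsto_atTop
  -- Parallelogram law for `F`, which is nonnegative on the constrained space. With coercivity and
  -- the convergence of `J` it makes the minimising sequence Cauchy in norm, so no weak limits are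
  -- needed.
  have hsub : ∀ x y : H, (∀ j < i, w x (ψ j) = 0) → (∀ j < i, w y (ψ j) = 0) →
      F (x - y) ≤ 2 * F x + 2 * F y := by
    intro x y hx hy
    have h1 : 0 ≤ F (x + y) := hF0 _ fun j hj => by simp [hx j hj, hy j hj]
    have h2 : F (x - y) + F (x + y) = 2 * F x + 2 * F y := by simp [F]; ring
    linarith
  have hcau : CauchySeq fun n => v (φ n) := by
    rw [cauchySeq_iff_tendsto_dist_atTop_0] at hJ ⊢
    have hsq : Tendsto (fun p : ℕ × ℕ => dist (v (φ p.1)) (v (φ p.2)) ^ 2) atTop (𝓝 0) := by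
      have hb : Tendsto (fun p : ℕ × ℕ => (2 * F (v (φ p.1)) + 2 * F (v (φ p.2))) +
          C * dist (J (v (φ p.1))) (J (v (φ p.2))) ^ 2) atTop (𝓝 0) := by
        have ha : Tendsto (fun p : ℕ × ℕ => F (v (φ p.1))) atTop (𝓝 0) := by
          rw [← prod_atTop_atTop_eq]; exact hFt.comp tendsto_fst
        have hb : Tendsto (fun p : ℕ × ℕ => F (v (φ p.2))) atTop (𝓝 0) := by
          rw [← prod_atTop_atTop_eq]; exact hFt.comp tendsto_snd
        simpa using ((ha.const_mul 2).add (hb.const_mul 2)).add ((hJ.pow 2).const_mul C)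
      refine squeeze_zero (fun p => sq_nonneg _) (fun p => ?_) hb
      have h1 := hFC (v (φ p.1) - v (φ p.2))
      have h2 := hsub _ _ (hvW (φ p.1)) (hvW (φ p.2))
      rw [dist_eq_norm, dist_eq_norm, ← map_sub]
      linarith
    have := hsq.sqrt
    simpa [Real.sqrt_sq dist_nonneg] using this
  obtain ⟨u, hu⟩ := cauchySeq_tendsto_of_complete hcau
  have hFc : Continuous F := by fun_prop
  have hFu : F u = 0 := tendsto_nhds_unique ((hFc.tendsto u).comp hu) hFt
  have hun : ‖u‖ = 1 := tendsto_nhds_unique hu.norm (by simp [hv1])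
  have hu0 : u ≠ 0 := by rintro rfl; simp at hun
  have huW : ∀ j < i, w u (ψ j) = 0 := fun j hj => by
    have hc : Continuous fun x => w x (ψ j) := by fun_prop
    exact tendsto_nhds_unique ((hc.tendsto u).comp hu) (by simp [Function.comp_def, hvW _ j hj])
  refine ⟨u, ⟨hu0, huW⟩, ?_⟩
  have hw0 : w u u ≠ 0 := fun h0 => by
    have := h.q_pos_of_w_eq_zero hu0 h0
    simp only [F, h0] at hFu
    linarith
  rw [div_eq_iff hw0]
  simp only [F] at hFu
  linarith

/-- Euler–Lagrange equation: along `v + t u` the function `q - Λ w` is a nonnegative quadratic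
polynomial in `t` that vanishes at `t = 0`, so its linear coefficient is zero. -/
lemma apply_eq_zero_of_isMinimizer (h : Admissible J q w) {i : ℕ} {v u : H}
    (hi : level q w ψ i < 0) (hv : IsMinimizer q w ψ i v) (hu : ∀ j < i, w u (ψ j) = 0)
    (huv : w v u = 0) : q v u = 0 := by
  have hw0 : w v v ≠ 0 := fun h0 => by
    have := hv.2
    rw [h0, div_zero] at this
    linarith
  have hqv : q v v = level q w ψ i * w v v := (div_eq_iff hw0).1 hv.2
  have key : ∀ t : ℝ, 0 ≤ (q u u - level q w ψ i * w u u) * (t * t) + (2 * q v u) * t + 0 := by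
    intro t
    have h1 := h.level_mul_le (ψ := ψ) (i := i) (v := v + t • u)
      fun j hj => by simp [hu j hj, hv.1.2 j hj]
    simp only [map_add, map_smul, _root_.add_apply, _root_.smul_apply,
      smul_eq_mul, h.w_symm u v, h.q_symm u v, huv] at h1
    nlinarith
  have := discrim_le_zero key
  rw [discrim] at this
  nlinarith [sq_nonneg (q v u)]

/-- If the first `k` levels are negative, then `q` is negative definite on a `k`-dimensional
space. -/
theorem exists_negative_space [CompleteSpace H] (h : Admissible J q w)
    (hψ : ∀ i, level q w ψ i < 0 → (∃ v, IsMinimizer q w ψ i v) → IsMinimizer q w ψ i (ψ i))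
    {k : ℕ} (hk : ∀ i < k, level q w ψ i < 0) :
    ∃ T : (Fin k → ℝ) →ₗ[ℝ] H, ∀ c, c ≠ 0 → q (T c) (T c) < 0 := by
  have hmin : ∀ i < k, IsMinimizer q w ψ i (ψ i) := fun i hi =>
    hψ i (hk i hi) (h.exists_isMinimizer (hk i hi))
  -- The later minimiser satisfies all constraints of the earlier one and is also `w`-orthogonal to
  -- it, so it is a valid test direction.
  have hlt : ∀ i j, j < k → i < j → q (ψ i) (ψ j) = 0 := fun i j hj hij =>
    h.apply_eq_zero_of_isMinimizer (hk i (hij.trans hj)) (hmin i (hij.trans hj))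
      (fun l hl => (hmin j hj).1.2 l (hl.trans hij))
      (by rw [h.w_symm]; exact (hmin j hj).1.2 i hij)
  have hne : ∀ i j : Fin k, i ≠ j → q (ψ i) (ψ j) = 0 := fun i j hij => by
    rcases lt_or_gt_of_ne hij with h1 | h1
    · exact hlt i j j.2 h1
    · rw [h.q_symm]; exact hlt j i i.2 h1
  have hneg : ∀ i : Fin k, q (ψ i) (ψ i) < 0 := fun i => by
    have h1 := (hmin i i.2).2
    have h2 := hk i i.2
    rw [← h1] at h2
    by_contra h3
    exact absurd h2 (not_lt.2 (div_nonneg (not_lt.1 h3) (h.w_nonneg _)))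
  refine ⟨Fintype.linearCombination ℝ (fun i : Fin k => ψ i), fun c hc => ?_⟩
  have hsum : q (Fintype.linearCombination ℝ (fun i : Fin k => ψ i) c)
      (Fintype.linearCombination ℝ (fun i : Fin k => ψ i) c) =
      ∑ i, c i ^ 2 * q (ψ i) (ψ i) := by
    simp only [Fintype.linearCombination_apply, map_sum, _root_.sum_apply, map_smul,
      _root_.smul_apply, smul_eq_mul]
    refine Finset.sum_congr rfl fun i _ => ?_
    rw [Finset.sum_eq_single i]
    · ring
    · intro j _ hj
      rw [hne _ _ hj]; ring
    · simp
  rw [hsum]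
  obtain ⟨i, hi⟩ := Function.ne_iff.1 hc
  refine Finset.sum_neg' (fun j _ => ?_) ⟨i, Finset.mem_univ _, ?_⟩
  · exact mul_nonpos_of_nonneg_of_nonpos (sq_nonneg _) (hneg j).le
  · exact mul_neg_of_pos_of_neg (by simpa using sq_pos_of_ne_zero hi) (hneg i)

/-- If `q` is negative definite on a space of dimension `> k`, then the level `k` is negative. -/
theorem level_neg_of_negative_space (h : Admissible J q w) {k m : ℕ} (hkm : k < m)
    (T : (Fin m → ℝ) →ₗ[ℝ] H) (hT : ∀ c, c ≠ 0 → q (T c) (T c) < 0) :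
    level q w ψ k < 0 := by
  -- The `k` constraints, pulled back to a space of dimension `m > k`, have a common nonzero
  -- solution.
  let S : (Fin m → ℝ) →ₗ[ℝ] (Fin k → ℝ) :=
    LinearMap.pi fun j => (w.flip (ψ j) : H →ₗ[ℝ] ℝ) ∘ₗ T
  obtain ⟨c, hcS, hc0⟩ : ∃ c ∈ LinearMap.ker S, c ≠ 0 := by
    apply Submodule.exists_mem_ne_zero_of_ne_bot
    apply LinearMap.ker_ne_bot_of_finrank_lt
    simpa using hkm
  have hq := hT c hc0
  have hw : ∀ j < k, w (T c) (ψ j) = 0 := fun j hj => by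
    have := congrFun (LinearMap.mem_ker.1 hcS) ⟨j, hj⟩
    simpa [S] using this
  have h1 := (h.level_mul_le hw).trans_lt hq
  by_contra h2
  exact absurd h1 (not_lt.2 (mul_nonneg (not_lt.1 h2) (h.w_nonneg _)))

theorem level_neg_transfer [CompleteSpace H] {w' : H →L[ℝ] H →L[ℝ] ℝ} {ψ' : ℕ → H}
    (h : Admissible J q w) (h' : Admissible J q w')
    (hψ : ∀ i, level q w ψ i < 0 → (∃ v, IsMinimizer q w ψ i v) → IsMinimizer q w ψ i (ψ i))
    {i : ℕ} (hi : level q w ψ i < 0) : level q w' ψ' i < 0 := by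
  obtain ⟨T, hT⟩ := h.exists_negative_space (k := i + 1) hψ fun j hj =>
    h.level_neg_of_le (Nat.lt_succ_iff.1 hj) hi
  exact h'.level_neg_of_negative_space (Nat.lt_succ_self i) T hT

end Admissible

end NegativeIndex

namespace SphericalSector

variable {N : ℕ} {D : Set (Space N)}

/-! ### Geometry of the cone and the sector -/

/-- Strict differentiability makes the descent uniform in the base point and the direction, as a
uniform cone property requires. -/
lemma eventually_decreasing {E : Type*} [NormedAddCommGroup E] [NormedSpace ℝ E] {f : E → ℝ}
    {f' : E →L[ℝ] ℝ} {x₀ c : E} (hf : HasStrictFDerivAt f f' x₀) (hc : f' c < 0) :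
    ∀ᶠ p : E × E × ℝ in 𝓝 x₀ ×ˢ 𝓝 c ×ˢ 𝓝[>] 0, f (p.1 + p.2.2 • p.2.1) < f p.1 := by
  obtain ⟨ε, hε, hεc⟩ : ∃ ε > 0, f' c + ε * ‖c‖ < 0 := by
    refine ⟨-f' c / (2 * (‖c‖ + 1)), by have := norm_nonneg c; apply div_pos <;> linarith, ?_⟩
    have := norm_nonneg c
    have h2 : -f' c / (2 * (‖c‖ + 1)) * ‖c‖ ≤ -f' c / 2 := by
      rw [div_mul_eq_mul_div, div_le_div_iff₀ (by positivity) (by positivity)]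
      nlinarith
    linarith
  have hfst : Tendsto (fun p : E × E × ℝ => p.1) (𝓝 x₀ ×ˢ 𝓝 c ×ˢ 𝓝[>] 0) (𝓝 x₀) := tendsto_fst
  have hw : Tendsto (fun p : E × E × ℝ => p.2.1) (𝓝 x₀ ×ˢ 𝓝 c ×ˢ 𝓝[>] 0) (𝓝 c) :=
    tendsto_fst.comp tendsto_snd
  have ht' : Tendsto (fun p : E × E × ℝ => p.2.2) (𝓝 x₀ ×ˢ 𝓝 c ×ˢ 𝓝[>] 0) (𝓝[>] 0) :=
    tendsto_snd.comp tendsto_snd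
  have ht : Tendsto (fun p : E × E × ℝ => p.2.2) (𝓝 x₀ ×ˢ 𝓝 c ×ˢ 𝓝[>] 0) (𝓝 0) :=
    ht'.mono_right nhdsWithin_le_nhds
  have hy : Tendsto (fun p : E × E × ℝ => p.1 + p.2.2 • p.2.1) (𝓝 x₀ ×ˢ 𝓝 c ×ˢ 𝓝[>] 0)
      (𝓝 x₀) := by simpa using hfst.add (ht.smul hw)
  have h1 := (hy.prodMk_nhds hfst).eventually (hf.isLittleO.def hε)
  have hcont : ContinuousAt (fun w => f' w + ε * ‖w‖) c := by fun_prop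
  have h2 := hw.eventually (hcont.eventually_lt_const hεc)
  have h3 := ht'.eventually self_mem_nhdsWithin
  filter_upwards [h1, h2, h3] with p hp1 hp2 hp3
  have hp3 : 0 < p.2.2 := hp3
  simp only [add_sub_cancel_left, map_smul, smul_eq_mul, norm_smul, Real.norm_eq_abs,
    abs_of_pos hp3] at hp1
  have := (abs_le.1 hp1).2
  nlinarith

/-- Radial projection to the sphere. -/
def project (x : Space N) : Space N := ‖x‖⁻¹ • x

lemma norm_project {x : Space N} (hx : x ≠ 0) : ‖project x‖ = 1 := by
  rw [project, norm_smul, norm_inv, norm_norm, inv_mul_cancel₀ (norm_ne_zero_iff.2 hx)]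

lemma project_smul {q : Space N} (hq : ‖q‖ = 1) {s : ℝ} (hs : 0 < s) : project (s • q) = q := by
  rw [project, norm_smul, hq, mul_one, Real.norm_of_nonneg hs.le, smul_smul,
    inv_mul_cancel₀ hs.ne', one_smul]

lemma norm_smul_project {x : Space N} (hx : x ≠ 0) : ‖x‖ • project x = x := by
  rw [project, smul_smul, mul_inv_cancel₀ (norm_ne_zero_iff.2 hx), one_smul]

lemma continuousAt_project {x : Space N} (hx : x ≠ 0) : ContinuousAt project x := by
  unfold project
  exact (continuousAt_id.norm.inv₀ (norm_ne_zero_iff.2 hx)).smul continuousAt_id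

/-- The differential of the radial projection kills the radial part and rescales the tangential one.
-/
lemma exists_hasStrictFDerivAt_project {x : Space N} (hx : x ≠ 0) :
    ∃ f' : Space N →L[ℝ] Space N, HasStrictFDerivAt project f' x ∧
      ∀ τ : Space N, inner ℝ x τ = 0 → f' (x + τ) = ‖x‖⁻¹ • τ := by
  have hn : 0 < ‖x‖ := norm_pos_iff.2 hx
  have h1 : HasStrictFDerivAt (fun y : Space N => ‖y‖ ^ 2) (2 • innerSL ℝ x) x :=
    hasStrictFDerivAt_norm_sq x
  have h2 := h1.sqrt (pow_pos hn 2).ne'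
  simp only [Real.sqrt_sq (norm_nonneg _)] at h2
  have h4 := (hasStrictDerivAt_inv hn.ne').comp_hasStrictFDerivAt x h2
  have h5 := h4.smul (hasStrictFDerivAt_id x)
  refine ⟨_, h5, fun τ hτ => ?_⟩
  simp [inner_add_right, hτ, smul_smul]
  have : (‖x‖ ^ 2)⁻¹ * (‖x‖⁻¹ * 2⁻¹) * (2 * ‖x‖ ^ 2) = ‖x‖⁻¹ := by field_simp
  rw [this]
  abel

lemma IsSmoothDomain.norm_eq_one (hD : IsSmoothDomain D) {q : Space N} (hq : q ∈ D) :
    ‖q‖ = 1 := by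
  obtain ⟨U, -, rfl⟩ := hD.relatively_open
  simpa using hq.1

lemma IsSmoothDomain.mem_cone_iff (hD : IsSmoothDomain D) {x : Space N} :
    x ∈ cone D ↔ x ≠ 0 ∧ project x ∈ D := by
  constructor
  · rintro ⟨q, hq, s, hs, rfl⟩
    have hq1 := hD.norm_eq_one hq
    refine ⟨?_, by rwa [project_smul hq1 hs]⟩
    rw [← norm_ne_zero_iff, norm_smul, hq1, mul_one]
    simpa using hs.ne'
  · rintro ⟨hx, hq⟩
    exact ⟨_, hq, ‖x‖, norm_pos_iff.2 hx, (norm_smul_project hx).symm⟩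

lemma IsSmoothDomain.mem_sector_iff (hD : IsSmoothDomain D) {x : Space N} :
    x ∈ sector D ↔ x ≠ 0 ∧ project x ∈ D ∧ ‖x‖ < 1 := by
  constructor
  · rintro ⟨q, hq, s, hs, hs1, rfl⟩
    have hq1 := hD.norm_eq_one hq
    refine ⟨(hD.mem_cone_iff.1 ⟨q, hq, s, hs, rfl⟩).1, by rwa [project_smul hq1 hs], ?_⟩
    rwa [norm_smul, hq1, mul_one, Real.norm_of_nonneg hs.le]
  · rintro ⟨hx, hq, h1⟩
    exact ⟨_, hq, ‖x‖, norm_pos_iff.2 hx, h1, (norm_smul_project hx).symm⟩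

lemma IsSmoothDomain.eventually_project_mem (hD : IsSmoothDomain D) {x : Space N} (hx : x ≠ 0)
    (hq : project x ∈ D) : ∀ᶠ y in 𝓝 x, y ≠ 0 ∧ project y ∈ D := by
  obtain ⟨U, hU, rfl⟩ := hD.relatively_open
  filter_upwards [isOpen_ne.mem_nhds hx, (continuousAt_project hx).eventually
    (hU.mem_nhds hq.2)] with y hy hyU
  exact ⟨hy, by simpa using norm_project hy, hyU⟩

lemma IsSmoothDomain.isOpen_cone (hD : IsSmoothDomain D) : IsOpen (cone D) := by
  rw [isOpen_iff_mem_nhds]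
  intro x hx
  obtain ⟨hx0, hxD⟩ := hD.mem_cone_iff.1 hx
  filter_upwards [hD.eventually_project_mem hx0 hxD] with y hy
  exact hD.mem_cone_iff.2 hy

lemma IsSmoothDomain.sector_eq (hD : IsSmoothDomain D) :
    sector D = cone D ∩ Metric.ball 0 1 := by
  ext x
  simp [hD.mem_sector_iff, hD.mem_cone_iff, and_assoc]

lemma IsSmoothDomain.isOpen_sector (hD : IsSmoothDomain D) : IsOpen (sector D) := by
  rw [hD.sector_eq]
  exact hD.isOpen_cone.inter Metric.isOpen_ball

lemma IsSmoothDomain.sector_subset_ball (hD : IsSmoothDomain D) :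
    sector D ⊆ Metric.ball 0 1 := by
  rw [hD.sector_eq]
  exact inter_subset_right

lemma IsSmoothDomain.project_mem_closure (hD : IsSmoothDomain D) {x : Space N} (hx : x ≠ 0)
    (hxS : x ∈ closure (sector D)) : project x ∈ closure D := by
  rw [mem_closure_iff_frequently] at hxS ⊢
  refine (continuousAt_project hx).tendsto.frequently (hxS.mono fun y hy => ?_)
  exact (hD.mem_sector_iff.1 hy).2.1

/-- Near any point of `closure D` there is a direction that points into the cone over `D`. -/
lemma IsSmoothDomain.exists_inward (hD : IsSmoothDomain D) {x₀ : Space N} (hx₀ : x₀ ≠ 0)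
    (hp : project x₀ ∈ closure D) : ∃ c : Space N, inner ℝ x₀ c < 0 ∧
      ∀ᶠ p : Space N × Space N × ℝ in 𝓝 x₀ ×ˢ 𝓝 c ×ˢ 𝓝[>] 0,
        project p.1 ∈ D → project (p.1 + p.2.2 • p.2.1) ∈ D := by
  have hneg : (inner ℝ x₀ (-x₀) : ℝ) < 0 := by
    rw [inner_neg_right, real_inner_self_eq_norm_sq]
    have : 0 < ‖x₀‖ := norm_pos_iff.2 hx₀
    nlinarith
  have hfst : ∀ c : Space N, Tendsto (fun p : Space N × Space N × ℝ => p.1)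
      (𝓝 x₀ ×ˢ 𝓝 c ×ˢ 𝓝[>] 0) (𝓝 x₀) := fun c => tendsto_fst
  have hy : ∀ c : Space N, Tendsto (fun p : Space N × Space N × ℝ => p.1 + p.2.2 • p.2.1)
      (𝓝 x₀ ×ˢ 𝓝 c ×ˢ 𝓝[>] 0) (𝓝 x₀) := fun c => by
    have hw : Tendsto (fun p : Space N × Space N × ℝ => p.2.1) (𝓝 x₀ ×ˢ 𝓝 c ×ˢ 𝓝[>] 0) (𝓝 c) :=
      tendsto_fst.comp tendsto_snd
    have ht : Tendsto (fun p : Space N × Space N × ℝ => p.2.2) (𝓝 x₀ ×ˢ 𝓝 c ×ˢ 𝓝[>] 0) (𝓝 0) :=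
      (tendsto_snd.comp tendsto_snd).mono_right nhdsWithin_le_nhds
    simpa using (hfst c).add (ht.smul hw)
  by_cases hpD : project x₀ ∈ D
  · refine ⟨-x₀, hneg, ?_⟩
    filter_upwards [(hy (-x₀)).eventually (hD.eventually_project_mem hx₀ hpD)] with p hp _
    exact hp.2
  · obtain ⟨U, hU, ρ, hρ, hDU, τ, hτ, hρτ⟩ := hD.smooth_boundary _ ⟨hp, hpD⟩
    have hn : 0 < ‖x₀‖ := norm_pos_iff.2 hx₀
    have hτ' : inner ℝ x₀ τ = 0 := by
      rw [project, real_inner_smul_left] at hτ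
      exact (mul_eq_zero.1 hτ).resolve_left (inv_ne_zero hn.ne')
    obtain ⟨f', hf', hf'τ⟩ := exists_hasStrictFDerivAt_project hx₀
    have hρ' : HasStrictFDerivAt ρ (fderiv ℝ ρ (project x₀)) (project x₀) :=
      hρ.contDiffAt.hasStrictFDerivAt (by simp)
    have hR := hρ'.comp x₀ hf'
    obtain ⟨σ, hσ, hρσ⟩ : ∃ σ : Space N, inner ℝ x₀ σ = 0 ∧ 0 < fderiv ℝ ρ (project x₀) σ := by
      rcases lt_or_gt_of_ne hρτ with h | h
      · exact ⟨-τ, by simp [hτ'], by simpa using h⟩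
      · exact ⟨τ, hτ', h⟩
    have hc : ((fderiv ℝ ρ (project x₀)).comp f') (-(x₀ + σ)) < 0 := by
      rw [map_neg, ContinuousLinearMap.comp_apply, hf'τ σ hσ, map_smul, neg_lt_zero]
      exact mul_pos (inv_pos.2 hn) hρσ
    -- The part `-σ` decreases the defining function `ρ ∘ project`; the part `-x₀` makes the norm
    -- decrease, which keeps the shifted points in the unit ball.
    refine ⟨-(x₀ + σ), ?_, ?_⟩
    · rw [neg_add, inner_add_right, inner_neg_right (𝕜 := ℝ) x₀ σ, hσ]
      simpa using hneg
    · have hUp : ∀ᶠ y in 𝓝 x₀, y ≠ 0 ∧ project y ∈ U :=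
        (isOpen_ne.eventually_mem hx₀).and ((continuousAt_project hx₀).eventually hU)
      filter_upwards [eventually_decreasing hR hc, (hfst _).eventually hUp,
        (hy _).eventually hUp] with p h1 h2 h3 h4
      have h5 : project p.1 ∈ D ∩ U := ⟨h4, h2.2⟩
      rw [hDU] at h5
      have h6 : project (p.1 + p.2.2 • p.2.1) ∈ D ∩ U := by
        rw [hDU]
        exact ⟨⟨by simpa using norm_project h3.1, h3.2⟩, h1.trans h5.2⟩
      exact h6.1

/-- The uniform cone property of the sector away from its vertex. -/
theorem IsSmoothDomain.exists_shift (hD : IsSmoothDomain D) {x₀ : Space N} (hx₀ : x₀ ≠ 0)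
    (hxS : x₀ ∈ closure (sector D)) : ∃ V ∈ 𝓝 x₀, ∀ ε : ℝ, 0 < ε → ∃ b : Space N, ∃ η : ℝ, 0 < η ∧
      ∀ x ∈ sector D ∩ V, ∀ w ∈ Metric.ball b η, ‖w‖ ≤ ε ∧
        ∀ s ∈ Ioc (0 : ℝ) 1, x + s • w ∈ sector D := by
  obtain ⟨c, hc, hev⟩ := hD.exists_inward hx₀ (hD.project_mem_closure hx₀ hxS)
  have hnorm := eventually_decreasing (hasStrictFDerivAt_norm_sq x₀) (c := c)
    (by simpa using by linarith)
  have hne : ∀ᶠ p : Space N × Space N × ℝ in 𝓝 x₀ ×ˢ 𝓝 c ×ˢ 𝓝[>] 0,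
      p.1 + p.2.2 • p.2.1 ≠ 0 := by
    have hw : Tendsto (fun p : Space N × Space N × ℝ => p.2.1) (𝓝 x₀ ×ˢ 𝓝 c ×ˢ 𝓝[>] 0) (𝓝 c) :=
      tendsto_fst.comp tendsto_snd
    have ht : Tendsto (fun p : Space N × Space N × ℝ => p.2.2) (𝓝 x₀ ×ˢ 𝓝 c ×ˢ 𝓝[>] 0) (𝓝 0) :=
      (tendsto_snd.comp tendsto_snd).mono_right nhdsWithin_le_nhds
    have hfst : Tendsto (fun p : Space N × Space N × ℝ => p.1)
      (𝓝 x₀ ×ˢ 𝓝 c ×ˢ 𝓝[>] 0) (𝓝 x₀) := tendsto_fst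
    have : Tendsto (fun p : Space N × Space N × ℝ => p.1 + p.2.2 • p.2.1)
      (𝓝 x₀ ×ˢ 𝓝 c ×ˢ 𝓝[>] 0) (𝓝 x₀) := by simpa using hfst.add (ht.smul hw)
    exact this.eventually (isOpen_ne.mem_nhds hx₀)
  have hall := (hev.and hnorm).and hne
  rw [((𝓝 x₀).basis_sets.prod (Metric.nhds_basis_ball.prod
    (nhdsGT_basis (0 : ℝ)))).eventually_iff] at hall
  obtain ⟨⟨V, δ, t₀⟩, ⟨hV, hδ, ht₀⟩, hall⟩ := hall
  simp only [id] at hV hδ ht₀ hall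
  refine ⟨V, hV, fun ε hε => ?_⟩
  have hk : 0 < ‖c‖ + δ := by have := norm_nonneg c; linarith
  obtain ⟨t, ht, htt₀, htε⟩ : ∃ t : ℝ, 0 < t ∧ t < t₀ ∧ t * (‖c‖ + δ) ≤ ε := by
    refine ⟨min (t₀ / 2) (ε / (‖c‖ + δ)), by positivity, ?_, ?_⟩
    · exact (min_le_left _ _).trans_lt (by linarith)
    · rw [← le_div_iff₀ hk]; exact min_le_right _ _
  -- The ball of admissible directions around `c`, scaled by a `t` so small that all its vectors
  -- have norm at most `ε`.
  refine ⟨t • c, t * δ, by positivity, fun x hx w hw => ?_⟩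
  obtain ⟨u, rfl⟩ : ∃ u, w = t • u := ⟨t⁻¹ • w, by rw [smul_smul, mul_inv_cancel₀ ht.ne', one_smul]⟩
  have hu : u ∈ Metric.ball c δ := by
    rw [mem_ball_iff_norm, ← smul_sub, norm_smul, Real.norm_of_nonneg ht.le] at hw
    exact mem_ball_iff_norm.2 (lt_of_mul_lt_mul_left hw ht.le)
  refine ⟨?_, fun s hs => ?_⟩
  · rw [norm_smul, Real.norm_of_nonneg ht.le]
    refine le_trans (mul_le_mul_of_nonneg_left ?_ ht.le) htε
    have := norm_sub_norm_le u c
    have := (mem_ball_iff_norm.1 hu).le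
    linarith
  · have hst : s * t ∈ Ioo 0 t₀ := ⟨mul_pos hs.1 ht, by nlinarith [hs.2, hs.1]⟩
    obtain ⟨⟨h1, h2⟩, h3⟩ := @hall (x, u, s * t) ⟨hx.2, hu, hst⟩
    obtain ⟨-, hxD, hx1⟩ := hD.mem_sector_iff.1 hx.1
    rw [smul_smul]
    refine hD.mem_sector_iff.2 ⟨h3, h1 hxD, ?_⟩
    exact (lt_of_pow_lt_pow_left₀ 2 (norm_nonneg _) h2).trans hx1

/-- Points of `D` lie in the closed sector but neither in the sector (their norm is `1`) nor in `Γ₁`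
(they are interior to the cone), so the support avoids them. This is the Dirichlet condition behind
Hardy's inequality. -/
lemma IsTestFunction.eq_zero_of_mem (hD : IsSmoothDomain D) {φ : Space N → ℝ}
    (hφ : IsTestFunction D φ) {q : Space N} (hq : q ∈ D) : φ q = 0 := by
  by_contra h0
  have hq1 := hD.norm_eq_one hq
  have hcl : q ∈ closure (sector D) := by
    have ht : Tendsto (fun s : ℝ => s • q) (𝓝[<] 1) (𝓝 q) := by
      have : Tendsto (fun s : ℝ => s • q) (𝓝 1) (𝓝 ((1 : ℝ) • q)) :=
        (continuous_id.smul continuous_const).tendsto 1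
      rw [one_smul] at this
      exact this.mono_left nhdsWithin_le_nhds
    refine mem_closure_of_tendsto ht ?_
    filter_upwards [Ioo_mem_nhdsLT (zero_lt_one' ℝ)] with s hs
    exact ⟨q, hq, s, hs.1, hs.2, rfl⟩
  rcases hφ.support_subset ⟨subset_tsupport _ h0, hcl⟩ with h | h
  · have := (hD.mem_sector_iff.1 h).2.2
    linarith
  · have hc : q ∈ cone D := ⟨q, hq, 1, one_pos, (one_smul _ _).symm⟩
    exact h.1.2 (by rwa [hD.isOpen_cone.interior_eq])

/-! ### Integral estimates and Hardy's inequality for test functions -/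

lemma sq_lintegral_mul_le {α : Type*} [MeasurableSpace α] (μ : Measure α) {f g : α → ℝ≥0∞}
    (hf : AEMeasurable f μ) (hg : AEMeasurable g μ) :
    (∫⁻ x, f x * g x ∂μ) ^ 2 ≤ (∫⁻ x, f x ^ 2 ∂μ) * ∫⁻ x, g x ^ 2 ∂μ := by
  have h := ENNReal.lintegral_mul_le_Lp_mul_Lq μ Real.HolderConjugate.two_two hf hg
  simp only [Pi.mul_apply, ENNReal.rpow_two] at h
  calc _ ≤ ((∫⁻ x, f x ^ 2 ∂μ) ^ (1 / 2 : ℝ) * (∫⁻ x, g x ^ 2 ∂μ) ^ (1 / 2 : ℝ)) ^ 2 := by gcongr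
    _ = _ := by
      rw [mul_pow, ← ENNReal.rpow_two, ← ENNReal.rpow_two, ← ENNReal.rpow_mul, ← ENNReal.rpow_mul]
      norm_num

lemma sq_lintegral_le {α : Type*} [MeasurableSpace α] (μ : Measure α) {f : α → ℝ≥0∞}
    (hf : AEMeasurable f μ) : (∫⁻ x, f x ∂μ) ^ 2 ≤ μ univ * ∫⁻ x, f x ^ 2 ∂μ := by
  simpa using sq_lintegral_mul_le μ (aemeasurable_const (b := (1 : ℝ≥0∞))) hf

lemma ennreal_add_sq_le (a b : ℝ≥0∞) : (a + b) ^ 2 ≤ 4 * (a ^ 2 + b ^ 2) := by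
  rcases le_total a b with h | h
  · calc (a + b) ^ 2 ≤ (b + b) ^ 2 := by gcongr
      _ = 4 * b ^ 2 := by ring
      _ ≤ _ := by gcongr; exact le_add_self
  · calc (a + b) ^ 2 ≤ (a + a) ^ 2 := by gcongr
      _ = 4 * a ^ 2 := by ring
      _ ≤ _ := by gcongr; exact le_self_add

lemma continuous_enorm_fderiv {E : Type*} [NormedAddCommGroup E] [NormedSpace ℝ E]
    {φ : E → ℝ} (hφ : ContDiff ℝ 1 φ) :
    Continuous fun x => ‖fderiv ℝ φ x‖ₑ :=
  (hφ.continuous_fderiv one_ne_zero).enorm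

lemma enorm_sub_le_lintegral_fderiv {E : Type*} [NormedAddCommGroup E] [NormedSpace ℝ E]
    {φ : E → ℝ} (hφ : ContDiff ℝ 1 φ) (x w : E) {a b : ℝ} (hab : a ≤ b) :
    ‖φ (x + b • w) - φ (x + a • w)‖ₑ ≤
      ∫⁻ s in Ioc a b, ‖w‖ₑ * ‖fderiv ℝ φ (x + s • w)‖ₑ := by
  have hd : ∀ s : ℝ, HasDerivAt (fun s : ℝ => φ (x + s • w)) (fderiv ℝ φ (x + s • w) w) s := by
    intro s
    have h1 : HasDerivAt (fun s : ℝ => x + s • w) ((1 : ℝ) • w) s :=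
      ((hasDerivAt_id s).smul_const w).const_add x
    rw [one_smul] at h1
    exact ((hφ.differentiable one_ne_zero) _).hasFDerivAt.comp_hasDerivAt s h1
  have hc : Continuous fun s : ℝ => fderiv ℝ φ (x + s • w) w :=
    ((hφ.continuous_fderiv one_ne_zero).comp (by fun_prop)).clm_apply continuous_const
  rw [← intervalIntegral.integral_eq_sub_of_hasDerivAt (fun s _ => hd s)
    (hc.intervalIntegrable _ _), intervalIntegral.integral_of_le hab]
  refine (enorm_integral_le_lintegral_enorm _).trans (lintegral_mono fun s => ?_)
  rw [mul_comm]
  exact ContinuousLinearMap.le_opENorm _ _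

lemma lintegral_comp_smul {f : Space N → ℝ≥0∞} (hf : Measurable f) {s : ℝ} (hs : 0 < s) :
    ∫⁻ x, f (s • x) = ENNReal.ofReal ((s ^ N)⁻¹) * ∫⁻ x, f x := by
  have h := Measure.map_addHaar_smul (volume : Measure (Space N)) hs.ne'
  rw [finrank_euclideanSpace_fin, abs_of_pos (by positivity)] at h
  rw [← lintegral_map hf (measurable_const_smul s), h, lintegral_smul_measure, smul_eq_mul]

/-- Integrate the gradient along the segment from `x` to `x + w`, then use Cauchy–Schwarz, Tonelli
and translation invariance. -/
lemma lintegral_shift_sub_le {φ : Space N → ℝ} (hφ : ContDiff ℝ 1 φ) {E Ω : Set (Space N)}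
    (hE : MeasurableSet E) (hΩ : MeasurableSet Ω) {w : Space N}
    (hw : ∀ x ∈ E, ∀ s ∈ Ioc (0 : ℝ) 1, x + s • w ∈ Ω) :
    ∫⁻ x in E, ‖φ (x + w) - φ x‖ₑ ^ 2 ≤ ‖w‖ₑ ^ 2 * ∫⁻ x in Ω, ‖fderiv ℝ φ x‖ₑ ^ 2 := by
  have hc := continuous_enorm_fderiv hφ
  have h1 : ∀ x, ‖φ (x + w) - φ x‖ₑ ^ 2 ≤
      ∫⁻ s in Ioc (0 : ℝ) 1, ‖w‖ₑ ^ 2 * ‖fderiv ℝ φ (x + s • w)‖ₑ ^ 2 := by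
    intro x
    have h := enorm_sub_le_lintegral_fderiv hφ x w (zero_le_one' ℝ)
    rw [one_smul, zero_smul, add_zero] at h
    have hm : Measurable fun s : ℝ => ‖w‖ₑ * ‖fderiv ℝ φ (x + s • w)‖ₑ :=
      (hc.comp (by fun_prop : Continuous fun s : ℝ => x + s • w)).measurable.const_mul _
    calc _ ≤ (∫⁻ s in Ioc (0 : ℝ) 1, ‖w‖ₑ * ‖fderiv ℝ φ (x + s • w)‖ₑ) ^ 2 := by gcongr
      _ ≤ _ := sq_lintegral_le _ hm.aemeasurable
      _ = _ := by simp [mul_pow]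
  have hm2 : Measurable (Function.uncurry fun (x : Space N) (s : ℝ) =>
      ‖w‖ₑ ^ 2 * ‖fderiv ℝ φ (x + s • w)‖ₑ ^ 2) :=
    ((hc.comp (by fun_prop : Continuous fun p : Space N × ℝ =>
      p.1 + p.2 • w)).measurable.pow_const 2).const_mul _
  calc _ ≤ ∫⁻ x in E, ∫⁻ s in Ioc (0 : ℝ) 1, ‖w‖ₑ ^ 2 * ‖fderiv ℝ φ (x + s • w)‖ₑ ^ 2 :=
        lintegral_mono h1
    _ = ∫⁻ s in Ioc (0 : ℝ) 1, ∫⁻ x in E, ‖w‖ₑ ^ 2 * ‖fderiv ℝ φ (x + s • w)‖ₑ ^ 2 :=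
        lintegral_lintegral_swap hm2.aemeasurable
    _ ≤ ∫⁻ s in Ioc (0 : ℝ) 1, ‖w‖ₑ ^ 2 * ∫⁻ x in Ω, ‖fderiv ℝ φ x‖ₑ ^ 2 := by
        refine setLIntegral_mono' measurableSet_Ioc fun s hs => ?_
        rw [lintegral_const_mul _
          (by exact ((hc.comp (by fun_prop : Continuous fun x : Space N =>
            x + s • w)).measurable.pow_const 2))]
        gcongr ‖w‖ₑ ^ 2 * ?_
        rw [← lintegral_indicator hE, ← lintegral_indicator hΩ,
          ← lintegral_add_right_eq_self (Ω.indicator fun x => ‖fderiv ℝ φ x‖ₑ ^ 2) (s • w)]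
        refine lintegral_mono fun x => ?_
        by_cases hx : x ∈ E
        · simp [hx, hw x hx s hs]
        · simp [hx]
    _ = _ := by simp

lemma lintegral_Ioi_rpow :
    ∫⁻ s in Ioi (1 : ℝ), ENNReal.ofReal (s ^ (-(3 / 2) : ℝ)) = 2 := by
  rw [← ofReal_integral_eq_lintegral_ofReal
    (integrableOn_Ioi_rpow_of_lt (by norm_num) one_pos) _,
    integral_Ioi_rpow_of_lt (by norm_num) one_pos]
  · norm_num
  · filter_upwards [ae_restrict_mem measurableSet_Ioi] with s hs
    have : (0 : ℝ) < s := one_pos.trans hs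
    positivity

/-- The ray through `x` leaves the sector at `‖x‖⁻¹ • x ∈ D`, where `φ` vanishes; integrate the
gradient back from there. -/
lemma IsSmoothDomain.enorm_le_lintegral_ray (hD : IsSmoothDomain D) {φ : Space N → ℝ}
    (hφ : ContDiff ℝ 1 φ) (hφ0 : ∀ q ∈ D, φ q = 0) {x : Space N} (hx : x ∈ sector D) :
    ‖φ x‖ₑ ≤ ‖x‖ₑ * ∫⁻ s in Ioi (1 : ℝ),
      (sector D).indicator (fun y => ‖fderiv ℝ φ y‖ₑ) (s • x) := by
  obtain ⟨hx0, hxD, hx1⟩ := hD.mem_sector_iff.1 hx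
  have hn : 0 < ‖x‖ := norm_pos_iff.2 hx0
  have h1 : 1 ≤ ‖x‖⁻¹ := (one_le_inv₀ hn).2 hx1.le
  have h := enorm_sub_le_lintegral_fderiv hφ 0 x h1
  simp only [zero_add, one_smul] at h
  rw [show φ (‖x‖⁻¹ • x) = 0 from hφ0 _ hxD, zero_sub, enorm_neg,
    setLIntegral_congr Ioo_ae_eq_Ioc.symm,
    lintegral_const_mul _ (by exact ((continuous_enorm_fderiv hφ).comp (by fun_prop)).measurable)] at h
  refine h.trans ?_
  gcongr ‖x‖ₑ * ?_
  calc ∫⁻ s in Ioo 1 ‖x‖⁻¹, ‖fderiv ℝ φ (s • x)‖ₑ =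
      ∫⁻ s in Ioo 1 ‖x‖⁻¹, (sector D).indicator (fun y => ‖fderiv ℝ φ y‖ₑ) (s • x) := by
        refine setLIntegral_congr_fun measurableSet_Ioo fun s hs => ?_
        have hs0 : 0 < s := one_pos.trans hs.1
        have hmem : s • x ∈ sector D := by
          refine ⟨project x, hxD, s * ‖x‖, by positivity, ?_, ?_⟩
          · have := mul_lt_mul_of_pos_right hs.2 hn
            rwa [inv_mul_cancel₀ hn.ne'] at this
          · rw [mul_smul, norm_smul_project hx0]
        simp only [indicator_of_mem hmem]
    _ ≤ _ := lintegral_mono_set Ioo_subset_Ioi_self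

/-- Hardy's inequality on the sector. -/
theorem IsSmoothDomain.hardy (hN : 3 ≤ N) (hD : IsSmoothDomain D) {φ : Space N → ℝ}
    (hφ : ContDiff ℝ 1 φ) (hφ0 : ∀ q ∈ D, φ q = 0) :
    ∫⁻ x in sector D, (‖x‖ₑ⁻¹ * ‖φ x‖ₑ) ^ 2 ≤ 4 * ∫⁻ x in sector D, ‖fderiv ℝ φ x‖ₑ ^ 2 := by
  set g : Space N → ℝ≥0∞ := (sector D).indicator (fun y => ‖fderiv ℝ φ y‖ₑ) with hg
  have hΩ := hD.isOpen_sector.measurableSet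
  have hgm : Measurable g := (continuous_enorm_fderiv hφ).measurable.indicator hΩ
  have hg2 : ∫⁻ x, g x ^ 2 = ∫⁻ x in sector D, ‖fderiv ℝ φ x‖ₑ ^ 2 := by
    rw [← lintegral_indicator hΩ]
    refine lintegral_congr fun x => ?_
    by_cases hx : x ∈ sector D <;> simp [hg, hx]
  -- Weights for Cauchy–Schwarz with `α β = 1`. The dilation `x ↦ s x` costs `s⁻ᴺ`, and for `N ≥ 3`
  -- both `α²` and `β² s⁻ᴺ` are at most `s^(-3/2)`, whose integral over `(1, ∞)` is `2`; hence the
  -- constant `4 = 2 · 2`.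
  let α : ℝ → ℝ≥0∞ := fun s => ENNReal.ofReal (s ^ (-(3 / 4) : ℝ))
  let β : ℝ → ℝ≥0∞ := fun s => ENNReal.ofReal (s ^ (3 / 4 : ℝ))
  have hα : Measurable α := by fun_prop
  have hβ : Measurable β := by fun_prop
  have hα2 : ∀ s ∈ Ioi (1 : ℝ), α s ^ 2 = ENNReal.ofReal (s ^ (-(3 / 2) : ℝ)) := fun s hs => by
    have hs0 : (0 : ℝ) < s := one_pos.trans hs
    simp only [α]
    rw [← ENNReal.ofReal_pow (by positivity), ← Real.rpow_natCast, ← Real.rpow_mul hs0.le]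
    norm_num
  have hαβ : ∀ s ∈ Ioi (1 : ℝ), α s * β s = 1 := fun s hs => by
    have hs0 : (0 : ℝ) < s := one_pos.trans hs
    simp only [α, β]
    rw [← ENNReal.ofReal_mul (by positivity), ← Real.rpow_add hs0]
    norm_num
  have hβN : ∀ s ∈ Ioi (1 : ℝ), β s ^ 2 * ENNReal.ofReal ((s ^ N)⁻¹) ≤
      ENNReal.ofReal (s ^ (-(3 / 2) : ℝ)) := fun s hs => by
    have hs1 : (1 : ℝ) < s := hs
    have hs0 : (0 : ℝ) < s := one_pos.trans hs1
    simp only [β]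
    rw [← ENNReal.ofReal_pow (by positivity), ← ENNReal.ofReal_mul (by positivity)]
    refine ENNReal.ofReal_le_ofReal ?_
    rw [← Real.rpow_natCast (s ^ _), ← Real.rpow_mul hs0.le, ← Real.rpow_natCast s N,
      ← Real.rpow_neg hs0.le, ← Real.rpow_add hs0]
    refine Real.rpow_le_rpow_of_exponent_le hs1.le ?_
    have : (3 : ℝ) ≤ N := by exact_mod_cast hN
    push_cast
    linarith
  have h1 : ∀ x ∈ sector D, (‖x‖ₑ⁻¹ * ‖φ x‖ₑ) ^ 2 ≤
      2 * ∫⁻ s in Ioi (1 : ℝ), (β s * g (s • x)) ^ 2 := by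
    intro x hx
    have hx0 := (hD.mem_sector_iff.1 hx).1
    have hgx : Measurable fun s : ℝ => g (s • x) := hgm.comp (by fun_prop)
    have h2 : ‖x‖ₑ⁻¹ * ‖φ x‖ₑ ≤ ∫⁻ s in Ioi (1 : ℝ), α s * (β s * g (s • x)) := by
      calc _ ≤ ‖x‖ₑ⁻¹ * (‖x‖ₑ * ∫⁻ s in Ioi (1 : ℝ), g (s • x)) := by
            gcongr; exact hD.enorm_le_lintegral_ray hφ hφ0 hx
        _ = ∫⁻ s in Ioi (1 : ℝ), g (s • x) := by
            rw [← mul_assoc, ENNReal.inv_mul_cancel (by simpa using hx0) (by simp), one_mul]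
        _ = _ := setLIntegral_congr_fun measurableSet_Ioi fun s hs => by
            simp only [← mul_assoc, hαβ s hs, one_mul]
    calc _ ≤ (∫⁻ s in Ioi (1 : ℝ), α s * (β s * g (s • x))) ^ 2 := by gcongr
      _ ≤ (∫⁻ s in Ioi (1 : ℝ), α s ^ 2) * ∫⁻ s in Ioi (1 : ℝ), (β s * g (s • x)) ^ 2 :=
          sq_lintegral_mul_le _ hα.aemeasurable (hβ.mul hgx).aemeasurable
      _ = _ := by rw [setLIntegral_congr_fun measurableSet_Ioi hα2, lintegral_Ioi_rpow]
  have hm : Measurable (Function.uncurry fun (x : Space N) (s : ℝ) => (β s * g (s • x)) ^ 2) :=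
    ((hβ.comp measurable_snd).mul (hgm.comp
      (by fun_prop : Continuous fun p : Space N × ℝ => p.2 • p.1).measurable)).pow_const 2
  calc _ ≤ ∫⁻ x in sector D, 2 * ∫⁻ s in Ioi (1 : ℝ), (β s * g (s • x)) ^ 2 :=
        setLIntegral_mono' hΩ h1
    _ ≤ ∫⁻ x, 2 * ∫⁻ s in Ioi (1 : ℝ), (β s * g (s • x)) ^ 2 := setLIntegral_le_lintegral _ _
    _ = 2 * ∫⁻ x, ∫⁻ s in Ioi (1 : ℝ), (β s * g (s • x)) ^ 2 :=
        lintegral_const_mul _ hm.lintegral_prod_right'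
    _ = 2 * ∫⁻ s in Ioi (1 : ℝ), ∫⁻ x, (β s * g (s • x)) ^ 2 := by
        rw [lintegral_lintegral_swap hm.aemeasurable]
    _ ≤ 2 * ∫⁻ s in Ioi (1 : ℝ), ENNReal.ofReal (s ^ (-(3 / 2) : ℝ)) * ∫⁻ x, g x ^ 2 := by
        gcongr 2 * ?_
        refine setLIntegral_mono' measurableSet_Ioi fun s hs => ?_
        have hs0 : (0 : ℝ) < s := one_pos.trans hs
        simp only [mul_pow]
        rw [lintegral_const_mul _ (by exact (hgm.comp (measurable_const_smul s)).pow_const 2),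
          lintegral_comp_smul (hgm.pow_const 2) hs0, ← mul_assoc]
        gcongr
        exact hβN s hs
    _ = 4 * ∫⁻ x in sector D, ‖fderiv ℝ φ x‖ₑ ^ 2 := by
        rw [lintegral_mul_const _ (by fun_prop), lintegral_Ioi_rpow, hg2, ← mul_assoc]
        norm_num

/-! ### Local averages and compactness for test functions -/

/-- A function differs from its local averages by a small multiple of its gradient. -/
lemma lintegral_sq_le_average {φ : Space N → ℝ} (hφ : ContDiff ℝ 1 φ)
    (hφc : HasCompactSupport φ) {E Ω : Set (Space N)}
    (hE : MeasurableSet E) (hΩ : MeasurableSet Ω) (ν : Measure (Space N)) [IsProbabilityMeasure ν]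
    {ε : ℝ≥0∞} (hw : ∀ᵐ w ∂ν, ‖w‖ₑ ≤ ε ∧ ∀ x ∈ E, ∀ s ∈ Ioc (0 : ℝ) 1, x + s • w ∈ Ω) :
    ∫⁻ x in E, ‖φ x‖ₑ ^ 2 ≤ 4 * ((∫⁻ x in E, ‖∫ w, φ (x + w) ∂ν‖ₑ ^ 2) +
      ε ^ 2 * ∫⁻ x in Ω, ‖fderiv ℝ φ x‖ₑ ^ 2) := by
  have hint : ∀ x, Integrable (fun w => φ (x + w)) ν := fun x => by
    obtain ⟨C, hC⟩ := hφc.exists_bound_of_continuous hφ.continuous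
    exact Integrable.of_bound (hφ.continuous.comp (by fun_prop)).aestronglyMeasurable C
      (ae_of_all _ fun w => hC _)
  have h1 : ∀ x, ‖φ x‖ₑ ^ 2 ≤ 4 * (‖∫ w, φ (x + w) ∂ν‖ₑ ^ 2 +
      ∫⁻ w, ‖φ (x + w) - φ x‖ₑ ^ 2 ∂ν) := by
    intro x
    have h2 : ‖φ x - ∫ w, φ (x + w) ∂ν‖ₑ ^ 2 ≤ ∫⁻ w, ‖φ (x + w) - φ x‖ₑ ^ 2 ∂ν := by
      have h3 : (∫ w, φ (x + w) ∂ν) - φ x = ∫ w, (φ (x + w) - φ x) ∂ν := by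
        rw [integral_sub (hint x) (integrable_const _)]; simp
      rw [enorm_sub_rev, h3]
      calc _ ≤ (∫⁻ w, ‖φ (x + w) - φ x‖ₑ ∂ν) ^ 2 := by
            gcongr; exact enorm_integral_le_lintegral_enorm _
        _ ≤ ν univ * ∫⁻ w, ‖φ (x + w) - φ x‖ₑ ^ 2 ∂ν := by
            refine sq_lintegral_le ν (Continuous.aemeasurable ?_)
            have := hφ.continuous
            fun_prop
        _ = _ := by simp
    calc ‖φ x‖ₑ ^ 2 = ‖(∫ w, φ (x + w) ∂ν) + (φ x - ∫ w, φ (x + w) ∂ν)‖ₑ ^ 2 := by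
          rw [add_sub_cancel]
      _ ≤ (‖∫ w, φ (x + w) ∂ν‖ₑ + ‖φ x - ∫ w, φ (x + w) ∂ν‖ₑ) ^ 2 := by
          gcongr; exact enorm_add_le _ _
      _ ≤ _ := ennreal_add_sq_le _ _
      _ ≤ _ := by gcongr
  have hφm := hφ.continuous
  have hAm : Measurable fun x => ∫ w, φ (x + w) ∂ν :=
    (StronglyMeasurable.integral_prod_right' (f := fun p : Space N × Space N => φ (p.1 + p.2))
      (by fun_prop : Continuous fun p : Space N × Space N => φ (p.1 + p.2)).stronglyMeasurable).measurable
  have hm : Measurable (Function.uncurry fun (x w : Space N) => ‖φ (x + w) - φ x‖ₑ ^ 2) :=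
    (by fun_prop : Continuous fun p : Space N × Space N => φ (p.1 + p.2) - φ p.1).enorm.measurable.pow_const 2
  calc _ ≤ ∫⁻ x in E, 4 * (‖∫ w, φ (x + w) ∂ν‖ₑ ^ 2 + ∫⁻ w, ‖φ (x + w) - φ x‖ₑ ^ 2 ∂ν) :=
        lintegral_mono h1
    _ = 4 * ((∫⁻ x in E, ‖∫ w, φ (x + w) ∂ν‖ₑ ^ 2) +
          ∫⁻ x in E, ∫⁻ w, ‖φ (x + w) - φ x‖ₑ ^ 2 ∂ν) := by
        rw [lintegral_const_mul' _ _ (by norm_num), lintegral_add_left (hAm.enorm.pow_const 2)]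
    _ = 4 * ((∫⁻ x in E, ‖∫ w, φ (x + w) ∂ν‖ₑ ^ 2) +
          ∫⁻ w, (∫⁻ x in E, ‖φ (x + w) - φ x‖ₑ ^ 2) ∂ν) := by
        rw [lintegral_lintegral_swap hm.aemeasurable]
    _ ≤ 4 * ((∫⁻ x in E, ‖∫ w, φ (x + w) ∂ν‖ₑ ^ 2) +
          ∫⁻ _, (ε ^ 2 * ∫⁻ x in Ω, ‖fderiv ℝ φ x‖ₑ ^ 2) ∂ν) := by
        gcongr 4 * (_ + ?_)
        refine lintegral_mono_ae (hw.mono fun w hw => ?_)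
        refine (lintegral_shift_sub_le hφ hE hΩ hw.2).trans ?_
        gcongr
        exact hw.1
    _ = _ := by simp

lemma integral_shift_cond (φ : Space N → ℝ) (b x : Space N) (η : ℝ) :
    ∫ w, φ (x + w) ∂(ProbabilityTheory.cond volume (Metric.ball b η)) =
      (volume (Metric.ball b η)).toReal⁻¹ * ∫ y in Metric.ball (x + b) η, φ y := by
  rw [ProbabilityTheory.cond, integral_smul_measure, ENNReal.toReal_inv, smul_eq_mul]
  congr 1
  rw [← integral_indicator Metric.isOpen_ball.measurableSet,
    ← integral_indicator Metric.isOpen_ball.measurableSet,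
    ← integral_add_left_eq_self ((Metric.ball (x + b) η).indicator φ) x]
  refine integral_congr_ae (ae_of_all _ fun w => ?_)
  by_cases h : w ∈ Metric.ball b η
  · have h' : x + w ∈ Metric.ball (x + b) η := by simpa [mem_ball_iff_norm] using h
    simp only [indicator_of_mem h, indicator_of_mem h']
  · have h' : x + w ∉ Metric.ball (x + b) η := by simpa [mem_ball_iff_norm] using h
    simp only [indicator_of_notMem h, indicator_of_notMem h']

lemma lintegral_shift_cond_le {f : Space N → ℝ≥0∞} {Ω : Set (Space N)} (b x : Space N) (η : ℝ)
    (hΩ : Metric.ball (x + b) η ⊆ Ω) :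
    ∫⁻ w, f (x + w) ∂(ProbabilityTheory.cond volume (Metric.ball b η)) ≤
      (volume (Metric.ball b η))⁻¹ * ∫⁻ y in Ω, f y := by
  rw [ProbabilityTheory.cond, lintegral_smul_measure, smul_eq_mul]
  gcongr (volume (Metric.ball b η))⁻¹ * ?_
  refine le_trans (le_of_eq ?_) (lintegral_mono_set hΩ)
  rw [← lintegral_indicator Metric.isOpen_ball.measurableSet,
    ← lintegral_indicator Metric.isOpen_ball.measurableSet,
    ← lintegral_add_left_eq_self ((Metric.ball (x + b) η).indicator f) x]
  refine lintegral_congr fun w => ?_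
  by_cases h : w ∈ Metric.ball b η
  · have h' : x + w ∈ Metric.ball (x + b) η := by simpa [mem_ball_iff_norm] using h
    simp only [indicator_of_mem h, indicator_of_mem h']
  · have h' : x + w ∉ Metric.ball (x + b) η := by simpa [mem_ball_iff_norm] using h
    simp only [indicator_of_notMem h, indicator_of_notMem h']

/-- A double sequence of functions, bounded in `H¹(Ω)`, whose integrals over balls tend to `0`,
tends to `0` in `L²` on any set that can be shifted into `Ω` by arbitrarily small balls. -/
lemma tendsto_lintegral_of_shift {d : ℕ × ℕ → Space N → ℝ} {Ω E : Set (Space N)}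
    (hΩ : MeasurableSet Ω) (hE : MeasurableSet E) (hEfin : volume E ≠ ⊤) {C : ℝ≥0∞} (hC : C ≠ ⊤)
    (hd : ∀ p, ContDiff ℝ 1 (d p)) (hdc : ∀ p, HasCompactSupport (d p))
    (hd0 : ∀ p, ∫⁻ x in Ω, ‖d p x‖ₑ ^ 2 ≤ C)
    (hd1 : ∀ p, ∫⁻ x in Ω, ‖fderiv ℝ (d p) x‖ₑ ^ 2 ≤ C)
    (hball : ∀ c η, Metric.ball c η ⊆ Ω →
      Tendsto (fun p => ∫ y in Metric.ball c η, d p y) atTop (𝓝 0))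
    (hshift : ∀ ε : ℝ, 0 < ε → ∃ b : Space N, ∃ η : ℝ, 0 < η ∧
      ∀ x ∈ E, ∀ w ∈ Metric.ball b η, ‖w‖ ≤ ε ∧ ∀ s ∈ Ioc (0 : ℝ) 1, x + s • w ∈ Ω) :
    Tendsto (fun p => ∫⁻ x in E, ‖d p x‖ₑ ^ 2) atTop (𝓝 0) := by
  -- The bound on `‖w‖` is supplied only together with a point of `E`.
  rcases E.eq_empty_or_nonempty with rfl | ⟨e, he⟩
  · simp
  rw [ENNReal.tendsto_nhds_zero]
  intro δ hδ
  obtain ⟨ε, hε, hεδ⟩ : ∃ ε : ℝ, 0 < ε ∧ 4 * (ENNReal.ofReal ε ^ 2 * C) ≤ δ / 2 := by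
    have ht : Tendsto (fun ε : ℝ => 4 * (ENNReal.ofReal ε ^ 2 * C)) (𝓝[>] 0) (𝓝 0) := by
      have h1 : Tendsto (fun ε : ℝ => ENNReal.ofReal ε) (𝓝[>] 0) (𝓝 0) := by
        have := (ENNReal.continuous_ofReal.tendsto 0)
        rw [ENNReal.ofReal_zero] at this
        exact this.mono_left nhdsWithin_le_nhds
      have h2 := ENNReal.Tendsto.const_mul (a := 4) (ENNReal.Tendsto.mul_const (b := C)
        (ENNReal.Tendsto.pow (n := 2) h1) (Or.inr hC)) (Or.inr (by norm_num))
      simpa using h2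
    have := (ENNReal.tendsto_nhds_zero.1 ht (δ / 2) (ENNReal.half_pos hδ.ne')).and
      self_mem_nhdsWithin
    obtain ⟨ε, h1, h2⟩ := this.exists
    exact ⟨ε, h2, h1⟩
  obtain ⟨b, η, hη, hb⟩ := hshift ε hε
  set ν := ProbabilityTheory.cond (volume : Measure (Space N)) (Metric.ball b η) with hν
  have hV0 : volume (Metric.ball b η) ≠ 0 := (Metric.measure_ball_pos volume b hη).ne'
  have : IsProbabilityMeasure ν := ProbabilityTheory.cond_isProbabilityMeasure_of_finite hV0 measure_ball_lt_top.ne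
  have hsub : ∀ x ∈ E, Metric.ball (x + b) η ⊆ Ω := fun x hx y hy => by
    have hw : y - x ∈ Metric.ball b η := by
      rw [mem_ball_iff_norm] at hy ⊢
      convert hy using 2; abel
    simpa using (hb x hx _ hw).2 1 ⟨one_pos, le_rfl⟩
  have hae : ∀ᵐ w ∂ν, ‖w‖ₑ ≤ ENNReal.ofReal ε ∧ ∀ x ∈ E, ∀ s ∈ Ioc (0 : ℝ) 1, x + s • w ∈ Ω := by
    filter_upwards [ProbabilityTheory.ae_cond_mem (μ := volume)
      (Metric.isOpen_ball (x := b) (ε := η)).measurableSet] with w hw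
    refine ⟨?_, fun x hx => (hb x hx w hw).2⟩
    rw [← ofReal_norm]
    exact ENNReal.ofReal_le_ofReal (hb e he w hw).1
  -- For fixed `b` and `η` the averages tend to `0` pointwise by `hball` and are bounded by a
  -- constant on a set of finite measure: dominated convergence.
  have hA : Tendsto (fun p => ∫⁻ x in E, ‖∫ w, d p (x + w) ∂ν‖ₑ ^ 2) atTop (𝓝 0) := by
    have h0 : (0 : ℝ≥0∞) = ∫⁻ _ in E, 0 := by simp
    rw [h0]
    refine tendsto_lintegral_filter_of_dominated_convergence
      (fun _ => (volume (Metric.ball b η))⁻¹ * C) ?_ ?_ ?_ ?_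
    · refine Eventually.of_forall fun p => ?_
      have hc := (hd p).continuous
      exact ((StronglyMeasurable.integral_prod_right'
        (f := fun q : Space N × Space N => d p (q.1 + q.2))
        (by fun_prop : Continuous fun q : Space N × Space N =>
          d p (q.1 + q.2)).stronglyMeasurable).measurable).enorm.pow_const 2
    · refine Eventually.of_forall fun p => ?_
      filter_upwards [ae_restrict_mem hE] with x hx
      calc _ ≤ (∫⁻ w, ‖d p (x + w)‖ₑ ∂ν) ^ 2 := by
            gcongr; exact enorm_integral_le_lintegral_enorm _
        _ ≤ ν univ * ∫⁻ w, ‖d p (x + w)‖ₑ ^ 2 ∂ν := by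
            refine sq_lintegral_le ν (Continuous.aemeasurable ?_)
            have := (hd p).continuous
            fun_prop
        _ = ∫⁻ w, ‖d p (x + w)‖ₑ ^ 2 ∂ν := by simp
        _ ≤ _ := lintegral_shift_cond_le (f := fun y => ‖d p y‖ₑ ^ 2) b x η (hsub x hx)
        _ ≤ _ := by gcongr; exact hd0 p
    · simp only [lintegral_const, Measure.restrict_apply_univ]
      exact ENNReal.mul_ne_top (ENNReal.mul_ne_top (ENNReal.inv_ne_top.2 hV0) hC) hEfin
    · filter_upwards [ae_restrict_mem hE] with x hx
      simp only [hν, integral_shift_cond]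
      have := (hball _ η (hsub x hx)).const_mul (volume (Metric.ball b η)).toReal⁻¹
      rw [mul_zero] at this
      have h2 := ENNReal.Tendsto.pow (n := 2) ((continuous_enorm.tendsto _).comp this)
      simpa using h2
  have hA' := ENNReal.Tendsto.const_mul (a := 4) hA (Or.inr (by norm_num))
  rw [mul_zero] at hA'
  filter_upwards [ENNReal.tendsto_nhds_zero.1 hA' (δ / 2) (ENNReal.half_pos hδ.ne')] with p hp
  refine (lintegral_sq_le_average (hd p) (hdc p) hE hΩ ν hae).trans ?_
  rw [mul_add, ← ENNReal.add_halves δ]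
  gcongr
  refine le_trans ?_ hεδ
  gcongr
  exact hd1 p

/-- The compactness of the embedding of `H¹` into `L²`, for double sequences of test
functions. -/
theorem IsSmoothDomain.tendsto_lintegral_sq (hN : 3 ≤ N) (hD : IsSmoothDomain D)
    {d : ℕ × ℕ → Space N → ℝ} {C : ℝ≥0∞} (hC : C ≠ ⊤)
    (hd : ∀ p, ContDiff ℝ 1 (d p)) (hdc : ∀ p, HasCompactSupport (d p))
    (hdD : ∀ p, ∀ q ∈ D, d p q = 0)
    (hd0 : ∀ p, ∫⁻ x in sector D, ‖d p x‖ₑ ^ 2 ≤ C)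
    (hd1 : ∀ p, ∫⁻ x in sector D, ‖fderiv ℝ (d p) x‖ₑ ^ 2 ≤ C)
    (hball : ∀ c η, Metric.ball c η ⊆ sector D →
      Tendsto (fun p => ∫ y in Metric.ball c η, d p y) atTop (𝓝 0)) :
    Tendsto (fun p => ∫⁻ x in sector D, ‖d p x‖ₑ ^ 2) atTop (𝓝 0) := by
  have hΩ := hD.isOpen_sector.measurableSet
  rw [ENNReal.tendsto_nhds_zero]
  intro δ hδ
  -- Near the vertex no shift is available; Hardy bounds the mass in the ball of radius `r` by `r² ·
  -- 4C`.
  obtain ⟨r, hr, hrδ⟩ : ∃ r : ℝ, 0 < r ∧ ENNReal.ofReal r ^ 2 * (4 * C) ≤ δ / 2 := by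
    have ht : Tendsto (fun ε : ℝ => ENNReal.ofReal ε ^ 2 * (4 * C)) (𝓝[>] 0) (𝓝 0) := by
      have h1 : Tendsto (fun ε : ℝ => ENNReal.ofReal ε) (𝓝[>] 0) (𝓝 0) := by
        have := (ENNReal.continuous_ofReal.tendsto 0)
        rw [ENNReal.ofReal_zero] at this
        exact this.mono_left nhdsWithin_le_nhds
      have h2 := ENNReal.Tendsto.mul_const (b := 4 * C)
        (ENNReal.Tendsto.pow (n := 2) h1) (Or.inr (ENNReal.mul_ne_top (by norm_num) hC))
      simpa using h2
    have := (ENNReal.tendsto_nhds_zero.1 ht (δ / 2) (ENNReal.half_pos hδ.ne')).and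
      self_mem_nhdsWithin
    obtain ⟨ε, h1, h2⟩ := this.exists
    exact ⟨ε, h2, h1⟩
  have hK : IsCompact (closure (sector D) \ Metric.ball 0 r) :=
    ((Metric.isBounded_ball.subset hD.sector_subset_ball).isCompact_closure).diff
      Metric.isOpen_ball
  have hgood : Tendsto (fun p => ∫⁻ x in sector D ∩ (closure (sector D) \ Metric.ball 0 r),
      ‖d p x‖ₑ ^ 2) atTop (𝓝 0) := by
    -- Away from the vertex the claim is local and finitely subadditive, so a neighbourhood of each
    -- point with its own shift suffices.
    refine hK.induction_on (p := fun s => Tendsto (fun p => ∫⁻ x in sector D ∩ s,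
      ‖d p x‖ₑ ^ 2) atTop (𝓝 0)) (by simp) ?_ ?_ ?_
    · intro s t hst ht
      exact tendsto_of_tendsto_of_tendsto_of_le_of_le tendsto_const_nhds ht
        (fun _ => bot_le) fun p => lintegral_mono_set (inter_subset_inter_right _ hst)
    · intro s t hs ht
      refine tendsto_of_tendsto_of_tendsto_of_le_of_le tendsto_const_nhds
        (by simpa using hs.add ht) (fun _ => bot_le) fun p => ?_
      rw [inter_union_distrib_left]
      exact lintegral_union_le _ _ _
    · intro x hx
      have hx0 : x ≠ 0 := by
        rintro rfl
        exact hx.2 (Metric.mem_ball_self hr)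
      obtain ⟨V, hV, hVs⟩ := hD.exists_shift hx0 hx.1
      obtain ⟨V', hV'V, hV'o, hxV'⟩ := mem_nhds_iff.1 hV
      refine ⟨V', mem_nhdsWithin_of_mem_nhds (hV'o.mem_nhds hxV'), ?_⟩
      refine tendsto_lintegral_of_shift hΩ (hΩ.inter hV'o.measurableSet) ?_ hC hd hdc hd0 hd1
        hball fun ε hε => ?_
      · refine ne_top_of_le_ne_top ?_
          (measure_mono (inter_subset_left.trans hD.sector_subset_ball))
        exact measure_ball_lt_top.ne
      · obtain ⟨b, η, hη, h⟩ := hVs ε hε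
        exact ⟨b, η, hη, fun x hx => h x ⟨hx.1, hV'V hx.2⟩⟩
  filter_upwards [ENNReal.tendsto_nhds_zero.1 hgood (δ / 2) (ENNReal.half_pos hδ.ne')] with p hp
  have hsplit : sector D ⊆ (sector D ∩ Metric.ball 0 r) ∪
      (sector D ∩ (closure (sector D) \ Metric.ball 0 r)) := fun x hx => by
    by_cases h : x ∈ Metric.ball 0 r
    · exact Or.inl ⟨hx, h⟩
    · exact Or.inr ⟨hx, subset_closure hx, h⟩
  refine (lintegral_mono_set hsplit).trans ((lintegral_union_le _ _ _).trans ?_)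
  rw [← ENNReal.add_halves δ]
  refine add_le_add ?_ hp
  refine le_trans ?_ hrδ
  calc ∫⁻ x in sector D ∩ Metric.ball 0 r, ‖d p x‖ₑ ^ 2
      ≤ ∫⁻ x in sector D ∩ Metric.ball 0 r,
          ENNReal.ofReal r ^ 2 * (‖x‖ₑ⁻¹ * ‖d p x‖ₑ) ^ 2 := by
        refine setLIntegral_mono' (hΩ.inter Metric.isOpen_ball.measurableSet) fun x hx => ?_
        have hx0 := (hD.mem_sector_iff.1 hx.1).1
        have hxr : ‖x‖ₑ ≤ ENNReal.ofReal r := by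
          rw [← ofReal_norm]
          exact ENNReal.ofReal_le_ofReal (by simpa using (mem_ball_zero_iff.1 hx.2).le)
        rw [← mul_pow, ← mul_assoc]
        gcongr
        calc ‖d p x‖ₑ = ‖x‖ₑ * ‖x‖ₑ⁻¹ * ‖d p x‖ₑ := by
              rw [ENNReal.mul_inv_cancel (by simpa using hx0) (by simp), one_mul]
          _ ≤ _ := by gcongr
    _ = ENNReal.ofReal r ^ 2 *
          ∫⁻ x in sector D ∩ Metric.ball 0 r, (‖x‖ₑ⁻¹ * ‖d p x‖ₑ) ^ 2 :=
        lintegral_const_mul' _ _ (by simp)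
    _ ≤ ENNReal.ofReal r ^ 2 * (4 * C) := by
        gcongr ENNReal.ofReal r ^ 2 * ?_
        refine (lintegral_mono_set inter_subset_left).trans
          ((hD.hardy hN (hd p) (hdD p)).trans ?_)
        gcongr
        exact hd1 p

/-! ### From test functions to the Sobolev space -/

lemma enorm_sq_eq_lintegral {α E : Type*} [MeasurableSpace α] [NormedAddCommGroup E]
    {μ : Measure α} (f : Lp E 2 μ) : ‖f‖ₑ ^ 2 = ∫⁻ x, ‖f x‖ₑ ^ 2 ∂μ := by
  rw [Lp.enorm_def]
  simpa using eLpNorm_nnreal_pow_eq_lintegral (μ := μ) (f := f) (p := 2) two_ne_zero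

lemma eLpNorm_two_sq {α E : Type*} [MeasurableSpace α] [NormedAddCommGroup E]
    {μ : Measure α} (f : α → E) : eLpNorm f 2 μ ^ 2 = ∫⁻ x, ‖f x‖ₑ ^ 2 ∂μ := by
  simpa using eLpNorm_nnreal_pow_eq_lintegral (μ := μ) (f := f) (p := 2) two_ne_zero

/-- Sequential Banach–Alaoglu, applied to the functionals `⟨f n, ·⟩`. -/
lemma exists_subseq_inner_cauchy {E : Type*} [NormedAddCommGroup E] [InnerProductSpace ℝ E]
    [TopologicalSpace.SeparableSpace E] {f : ℕ → E} {r : ℝ} (hf : ∀ n, ‖f n‖ ≤ r) :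
    ∃ σ : ℕ → ℕ, StrictMono σ ∧ ∀ g : E, ∃ l : ℝ,
      Tendsto (fun n => inner ℝ g (f (σ n))) atTop (𝓝 l) := by
  obtain ⟨u, -, σ, hσ, hu⟩ := WeakDual.isSeqCompact_closedBall ℝ E 0 r
    (x := fun n => StrongDual.toWeakDual (innerSL ℝ (f n)))
    (fun n => by simpa using hf n)
  refine ⟨σ, hσ, fun g => ⟨u g, ?_⟩⟩
  have := ((WeakDual.eval_continuous g).tendsto u).comp hu
  refine this.congr fun n => ?_
  simp [real_inner_comm]

lemma norm_gradient {E : Type*} [NormedAddCommGroup E] [InnerProductSpace ℝ E] [CompleteSpace E]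
    (f : E → ℝ) (x : E) : ‖gradient f x‖ = ‖fderiv ℝ f x‖ := by
  simp [gradient]

lemma IsTestFunction.add {φ χ : Space N → ℝ} (hφ : IsTestFunction D φ) (hχ : IsTestFunction D χ) :
    IsTestFunction D (φ + χ) where
  contDiff := hφ.contDiff.add hχ.contDiff
  hasCompactSupport := hφ.hasCompactSupport.add hχ.hasCompactSupport
  support_subset := by
    rintro x ⟨hx, hxS⟩
    rcases tsupport_add φ χ hx with h | h
    · exact hφ.support_subset ⟨h, hxS⟩
    · exact hχ.support_subset ⟨h, hxS⟩

lemma IsTestFunction.smul {φ : Space N → ℝ} (hφ : IsTestFunction D φ) (c : ℝ) :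
    IsTestFunction D (c • φ) where
  contDiff := contDiff_const.smul hφ.contDiff
  hasCompactSupport := hφ.hasCompactSupport.smul_left (f := fun _ => c)
  support_subset := by
    rintro x ⟨hx, hxS⟩
    exact hφ.support_subset ⟨closure_mono (Function.support_const_smul_subset c φ) hx, hxS⟩

lemma IsTestFunction.zero : IsTestFunction D (0 : Space N → ℝ) where
  contDiff := contDiff_const
  hasCompactSupport := HasCompactSupport.zero
  support_subset := by simp [tsupport]

lemma gradient_add_of_contDiff {φ χ : Space N → ℝ} (hφ : ContDiff ℝ 1 φ) (hχ : ContDiff ℝ 1 χ)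
    (x : Space N) : gradient (φ + χ) x = gradient φ x + gradient χ x := by
  simp [gradient, fderiv_add (hφ.differentiable one_ne_zero x) (hχ.differentiable one_ne_zero x)]

lemma gradient_smul_of_contDiff {φ : Space N → ℝ} (hφ : ContDiff ℝ 1 φ) (c : ℝ)
    (x : Space N) : gradient (c • φ) x = c • gradient φ x := by
  simp [gradient, fderiv_const_smul (hφ.differentiable one_ne_zero x)]

lemma mem_testPairs_of_mem_span {p : PairSpace D} (hp : p ∈ Submodule.span ℝ (testPairs D)) :
    p ∈ testPairs D := by
  induction hp using Submodule.span_induction with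
  | mem x h => exact h
  | zero =>
    refine ⟨0, IsTestFunction.zero, ?_, ?_⟩
    · exact Lp.coeFn_zero _ _ _
    · refine (Lp.coeFn_zero _ _ _).trans (ae_of_all _ fun x => ?_)
      simp [gradient]
  | add x y _ _ hx hy =>
    obtain ⟨φ, hφ, h1, h2⟩ := hx
    obtain ⟨χ, hχ, h3, h4⟩ := hy
    refine ⟨φ + χ, hφ.add hχ, ?_, ?_⟩
    · exact (Lp.coeFn_add _ _).trans (h1.add h3)
    · refine (Lp.coeFn_add _ _).trans ((h2.add h4).trans (ae_of_all _ fun x => ?_))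
      exact (gradient_add_of_contDiff hφ.contDiff hχ.contDiff x).symm
  | smul c x _ hx =>
    obtain ⟨φ, hφ, h1, h2⟩ := hx
    refine ⟨c • φ, hφ.smul c, ?_, ?_⟩
    · exact (Lp.coeFn_smul _ _).trans (h1.const_smul c)
    · refine (Lp.coeFn_smul _ _).trans ((h2.const_smul c).trans (ae_of_all _ fun x => ?_))
      exact (gradient_smul_of_contDiff hφ.contDiff c x).symm

lemma exists_testPair_near (v : H10 D) {ε : ℝ} (hε : 0 < ε) : ∃ p ∈ testPairs D, ‖p - v.1‖ < ε := by
  have hv : v.1 ∈ closure (Submodule.span ℝ (testPairs D) : Set (PairSpace D)) := v.2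
  obtain ⟨p, hp, hd⟩ := Metric.mem_closure_iff.1 hv ε hε
  refine ⟨p, mem_testPairs_of_mem_span hp, ?_⟩
  rwa [dist_comm, dist_eq_norm] at hd

lemma norm_pair_fst_le (p : PairSpace D) : ‖p.fst‖ ≤ ‖p‖ := WithLp.norm_fst_le _ p
lemma norm_pair_snd_le (p : PairSpace D) : ‖p.snd‖ ≤ ‖p‖ := WithLp.norm_snd_le _ p

/-- Hardy's inequality on `H¹₀(S_D ∪ Γ₁)`. -/
theorem IsSmoothDomain.hardy_H10 (hN : 3 ≤ N) (hD : IsSmoothDomain D) (v : H10 D) :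
    ∫⁻ x in sector D, (‖x‖ₑ⁻¹ * ‖value v x‖ₑ) ^ 2 ≤ 4 * ‖v‖ₑ ^ 2 := by
  choose p hp hpv using fun n : ℕ => exists_testPair_near v (Nat.one_div_pos_of_nat (n := n))
  have hlim : Tendsto p atTop (𝓝 v.1) := by
    rw [tendsto_iff_norm_sub_tendsto_zero]
    exact squeeze_zero (fun _ => norm_nonneg _) (fun n => (hpv n).le)
      tendsto_one_div_add_atTop_nhds_zero_nat
  have hfst : Tendsto (fun n => (p n).fst) atTop (𝓝 v.1.fst) :=
    ((WithLp.fstL 2 ℝ _ _).continuous.tendsto v.1).comp hlim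
  obtain ⟨σ, hσ, hae⟩ := (tendstoInMeasure_of_tendsto_Lp hfst).exists_seq_tendsto_ae
  have hbound : ∀ n, ∫⁻ x in sector D, (‖x‖ₑ⁻¹ * ‖(p n).fst x‖ₑ) ^ 2 ≤ 4 * ‖p n‖ₑ ^ 2 := by
    intro n
    obtain ⟨φ, hφ, h1, h2⟩ := hp n
    calc _ = ∫⁻ x in sector D, (‖x‖ₑ⁻¹ * ‖φ x‖ₑ) ^ 2 :=
          lintegral_congr_ae (h1.mono fun x hx => by simp only [hx])
      _ ≤ 4 * ∫⁻ x in sector D, ‖fderiv ℝ φ x‖ₑ ^ 2 :=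
          hD.hardy hN hφ.contDiff fun q hq => hφ.eq_zero_of_mem hD hq
      _ = 4 * ‖(p n).snd‖ₑ ^ 2 := by
          rw [enorm_sq_eq_lintegral]
          congr 1
          refine lintegral_congr_ae (h2.mono fun x hx => ?_)
          simp only [hx]
          rw [← ofReal_norm, ← ofReal_norm, norm_gradient]
      _ ≤ _ := by
          gcongr
          rw [← ofReal_norm, ← ofReal_norm]
          exact ENNReal.ofReal_le_ofReal (norm_pair_snd_le _)
  -- Hardy passes to the limit by Fatou along an almost everywhere convergent subsequence.
  have hpt : ∀ᵐ x ∂sectorMeasure D, (‖x‖ₑ⁻¹ * ‖value v x‖ₑ) ^ 2 ≤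
      liminf (fun n => (‖x‖ₑ⁻¹ * ‖(p (σ n)).fst x‖ₑ) ^ 2) atTop := by
    filter_upwards [hae, ae_restrict_mem hD.isOpen_sector.measurableSet] with x hx hxS
    have hx0 := (hD.mem_sector_iff.1 hxS).1
    have h1 := ENNReal.Tendsto.const_mul (a := ‖x‖ₑ⁻¹) hx.enorm
      (Or.inr (ENNReal.inv_ne_top.2 (by simpa using hx0)))
    exact (ENNReal.Tendsto.pow (n := 2) h1).liminf_eq.ge
  have hnorm : Tendsto (fun n => 4 * ‖p (σ n)‖ₑ ^ 2) atTop (𝓝 (4 * ‖v‖ₑ ^ 2)) :=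
    ENNReal.Tendsto.const_mul (ENNReal.Tendsto.pow (n := 2) (hlim.comp hσ.tendsto_atTop).enorm)
      (Or.inr (by norm_num))
  calc _ ≤ ∫⁻ x in sector D, liminf (fun n => (‖x‖ₑ⁻¹ * ‖(p (σ n)).fst x‖ₑ) ^ 2) atTop :=
        lintegral_mono_ae hpt
    _ ≤ liminf (fun n => ∫⁻ x in sector D, (‖x‖ₑ⁻¹ * ‖(p (σ n)).fst x‖ₑ) ^ 2) atTop :=
        lintegral_liminf_le' fun n =>
          ((by fun_prop : Measurable fun x : Space N => ‖x‖ₑ⁻¹).aemeasurable.mul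
            (Lp.aestronglyMeasurable _).enorm).pow_const 2
    _ ≤ liminf (fun n => 4 * ‖p (σ n)‖ₑ ^ 2) atTop :=
        liminf_le_liminf (Eventually.of_forall fun n => hbound _)
    _ = _ := hnorm.liminf_eq

/-- The inclusion of `H¹₀(S_D ∪ Γ₁)` in `L²(S_D)`. -/
def inclusion (D : Set (Space N)) : H10 D →L[ℝ] Lp ℝ 2 (sectorMeasure D) :=
  (WithLp.fstL 2 ℝ _ _).comp (H10 D).subtypeL

/-- The weak gradient as an operator. -/
def gradOp (D : Set (Space N)) : H10 D →L[ℝ] Lp (Space N) 2 (sectorMeasure D) :=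
  (WithLp.sndL 2 ℝ _ _).comp (H10 D).subtypeL

lemma norm_sq_eq (v : H10 D) : ‖v‖ ^ 2 = ‖inclusion D v‖ ^ 2 + ‖gradOp D v‖ ^ 2 :=
  WithLp.prod_norm_sq_eq_of_L2 v.1

lemma enorm_sub_fst_sq {p p' : PairSpace D} {φ φ' : Space N → ℝ}
    (h : p.fst =ᵐ[sectorMeasure D] φ) (h' : p'.fst =ᵐ[sectorMeasure D] φ') :
    ‖p.fst - p'.fst‖ₑ ^ 2 = ∫⁻ x in sector D, ‖φ x - φ' x‖ₑ ^ 2 := by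
  rw [enorm_sq_eq_lintegral]
  refine lintegral_congr_ae ?_
  filter_upwards [Lp.coeFn_sub p.fst p'.fst, h, h'] with x h1 h2 h3
  rw [h1, Pi.sub_apply, h2, h3]

/-- The embedding of `H¹₀(S_D ∪ Γ₁)` in `L²(S_D)` is compact. -/
theorem IsSmoothDomain.inclusion_compact (hN : 3 ≤ N) (hD : IsSmoothDomain D) (v : ℕ → H10 D)
    (hv : ∀ n, ‖v n‖ ≤ 1) :
    ∃ σ : ℕ → ℕ, StrictMono σ ∧ CauchySeq fun n => inclusion D (v (σ n)) := by
  choose p hp hpv using fun n : ℕ => exists_testPair_near (v n) (Nat.one_div_pos_of_nat (n := n))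
  have hp2 : ∀ n, ‖p n‖ ≤ 2 := fun n => by
    have h1 := norm_le_norm_sub_add (p n) (v n).1
    have h2 : (1 : ℝ) / (n + 1) ≤ 1 := by
      rw [div_le_one (by positivity)]; linarith [n.cast_nonneg (α := ℝ)]
    have h3 : ‖(v n).1‖ ≤ 1 := hv n
    linarith [hpv n]
  have : Fact ((2 : ℝ≥0∞) ≠ ⊤) := ⟨ENNReal.ofNat_ne_top⟩
  obtain ⟨σ, hσ, hw⟩ := exists_subseq_inner_cauchy (f := fun n => (p n).fst)
    fun n => (norm_pair_fst_le _).trans (hp2 n)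
  choose φ hφ hφ1 hφ2 using hp
  -- Differences of approximating test functions: the Cauchy property is proved directly, so the
  -- weak limit need not lie in `H10 D`.
  let d : ℕ × ℕ → Space N → ℝ := fun q x => φ (σ q.1) x - φ (σ q.2) x
  have hdist : ∀ q : ℕ × ℕ, ‖p (σ q.1) - p (σ q.2)‖ ≤ 4 := fun q => by
    have := norm_sub_le (p (σ q.1)) (p (σ q.2))
    linarith [hp2 (σ q.1), hp2 (σ q.2)]
  have hd0 : ∀ q : ℕ × ℕ, ∫⁻ x in sector D, ‖d q x‖ₑ ^ 2 =
      ‖(p (σ q.1)).fst - (p (σ q.2)).fst‖ₑ ^ 2 := fun q =>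
    (enorm_sub_fst_sq (hφ1 _) (hφ1 _)).symm
  have hd1 : ∀ q : ℕ × ℕ, ∫⁻ x in sector D, ‖fderiv ℝ (d q) x‖ₑ ^ 2 =
      ‖(p (σ q.1)).snd - (p (σ q.2)).snd‖ₑ ^ 2 := fun q => by
    rw [enorm_sq_eq_lintegral]
    refine lintegral_congr_ae ?_
    filter_upwards [Lp.coeFn_sub (p (σ q.1)).snd (p (σ q.2)).snd, hφ2 (σ q.1), hφ2 (σ q.2)]
      with x h1 h2 h3
    have h4 : fderiv ℝ (d q) x = fderiv ℝ (φ (σ q.1)) x - fderiv ℝ (φ (σ q.2)) x :=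
      fderiv_fun_sub ((hφ _).contDiff.differentiable one_ne_zero x)
        ((hφ _).contDiff.differentiable one_ne_zero x)
    rw [h1, Pi.sub_apply, h2, h3, h4, ← ofReal_norm, ← ofReal_norm]
    simp only [gradient]
    rw [← map_sub, LinearIsometryEquiv.norm_map]
  have hT : Tendsto (fun q => ∫⁻ x in sector D, ‖d q x‖ₑ ^ 2) atTop (𝓝 0) := by
    have h16 : ∀ {E : Type _} [NormedAddCommGroup E] (x : E), ‖x‖ ≤ 4 → ‖x‖ₑ ^ 2 ≤ 16 := by
      intro E _ x hx
      have : ‖x‖ₑ ≤ 4 := by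
        rw [← ofReal_norm]
        exact ENNReal.ofReal_le_of_le_toReal (by simpa using hx)
      calc _ ≤ (4 : ℝ≥0∞) ^ 2 := by gcongr
        _ = 16 := by norm_num
    refine hD.tendsto_lintegral_sq hN (C := 16) (by norm_num) ?_ ?_ ?_ ?_ ?_ ?_
    · exact fun q => (hφ _).contDiff.sub (hφ _).contDiff
    · intro q
      have := (hφ (σ q.1)).hasCompactSupport.add ((hφ (σ q.2)).hasCompactSupport.neg)
      have h : d q = φ (σ q.1) + -φ (σ q.2) := by
        ext x; simp [d, sub_eq_add_neg]
      rw [h]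
      exact this
    · intro q x hx
      simp [d, (hφ _).eq_zero_of_mem hD hx]
    · intro q
      rw [hd0]
      exact h16 _ ((norm_pair_fst_le (p (σ q.1) - p (σ q.2))).trans (hdist q))
    · intro q
      rw [hd1]
      exact h16 _ ((norm_pair_snd_le (p (σ q.1) - p (σ q.2))).trans (hdist q))
    · intro c η hc
      have hB : MeasurableSet (Metric.ball c η) := Metric.isOpen_ball.measurableSet
      have hBfin : sectorMeasure D (Metric.ball c η) ≠ ⊤ :=
        ne_top_of_le_ne_top measure_ball_lt_top.ne (Measure.restrict_apply_le _ _)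
      -- Integrals over a ball are inner products with its indicator, so weak convergence controls
      -- them.
      obtain ⟨l, hl⟩ := hw (indicatorConstLp 2 hB hBfin (1 : ℝ))
      have hl' : Tendsto (fun n => ∫ x in Metric.ball c η, φ (σ n) x) atTop (𝓝 l) := by
        refine hl.congr fun n => ?_
        rw [L2.inner_indicatorConstLp_one, Measure.restrict_restrict hB,
          inter_eq_self_of_subset_left hc]
        exact integral_congr_ae (ae_restrict_of_ae_restrict_of_subset hc (hφ1 (σ n)))
      have h1 : Tendsto (fun q : ℕ × ℕ => (∫ x in Metric.ball c η, φ (σ q.1) x) -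
          ∫ x in Metric.ball c η, φ (σ q.2) x) atTop (𝓝 0) := by
        rw [← sub_self l, ← prod_atTop_atTop_eq]
        exact (hl'.comp tendsto_fst).sub (hl'.comp tendsto_snd)
      refine h1.congr fun q => ?_
      have hi : ∀ n, IntegrableOn (φ n) (Metric.ball c η) := fun n =>
        ((hφ n).contDiff.continuous.integrable_of_hasCompactSupport
          (hφ n).hasCompactSupport).integrableOn
      exact (integral_sub (hi _) (hi _)).symm
  refine ⟨σ, hσ, ?_⟩
  have hpc : CauchySeq fun n => (p (σ n)).fst := by
    rw [cauchySeq_iff_tendsto_dist_atTop_0]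
    simp only [hd0] at hT
    have h2 := ((ENNReal.tendsto_toReal ENNReal.zero_ne_top).comp hT).sqrt
    simpa [Function.comp_def, dist_eq_norm, Real.sqrt_sq (norm_nonneg _)] using h2
  have hdiff : Tendsto (fun n => dist (p (σ n)).fst (inclusion D (v (σ n)))) atTop (𝓝 0) := by
    refine squeeze_zero (fun _ => dist_nonneg) (fun n => ?_)
      (tendsto_one_div_add_atTop_nhds_zero_nat.comp hσ.tendsto_atTop)
    rw [dist_eq_norm]
    exact (norm_pair_fst_le (p (σ n) - (v (σ n)).1)).trans (hpv _).le
  obtain ⟨u, hu⟩ := cauchySeq_tendsto_of_complete hpc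
  exact ((tendsto_iff_of_dist hdiff).1 hu).cauchySeq

/-! ### Energy and pairings as bounded bilinear forms -/

/-- The bilinear form `⟨A u, B v⟩`. -/
def innerForm {H L : Type*} [NormedAddCommGroup H] [NormedSpace ℝ H] [NormedAddCommGroup L]
    [InnerProductSpace ℝ L] (A B : H →L[ℝ] L) : H →L[ℝ] H →L[ℝ] ℝ :=
  LinearMap.mkContinuous₂ (LinearMap.mk₂ ℝ (fun u v => inner ℝ (A u) (B v))
    (fun u u' v => by simp [inner_add_left]) (fun c u v => by simp [inner_smul_left])
    (fun u v v' => by simp [inner_add_right]) (fun c u v => by simp [inner_smul_right]))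
    (‖A‖ * ‖B‖) fun u v => by
      calc ‖inner ℝ (A u) (B v)‖ ≤ ‖A u‖ * ‖B v‖ := norm_inner_le_norm _ _
        _ ≤ (‖A‖ * ‖u‖) * (‖B‖ * ‖v‖) := by gcongr <;> exact ContinuousLinearMap.le_opNorm _ _
        _ = _ := by ring

@[simp]
lemma innerForm_apply {H L : Type*} [NormedAddCommGroup H] [NormedSpace ℝ H]
    [NormedAddCommGroup L] [InnerProductSpace ℝ L] (A B : H →L[ℝ] L) (u v : H) :
    innerForm A B u v = inner ℝ (A u) (B v) := rfl

lemma innerForm_symm {H L : Type*} [NormedAddCommGroup H] [NormedSpace ℝ H]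
    [NormedAddCommGroup L] [InnerProductSpace ℝ L] (A : H →L[ℝ] L) (u v : H) :
    innerForm A A u v = innerForm A A v u := real_inner_comm (A v) (A u)

lemma coeFn_inclusion (v : H10 D) : (inclusion D v : Space N → ℝ) = value v := rfl

lemma exists_multiplier {m : Space N → ℝ} (hm : AEStronglyMeasurable m (sectorMeasure D))
    {C : ℝ} (hC : 0 ≤ C)
    (hmC : ∀ v : H10 D, eLpNorm (fun x => m x * value v x) 2 (sectorMeasure D) ≤
      ENNReal.ofReal C * ‖v‖ₑ) :
    ∃ T : H10 D →L[ℝ] Lp ℝ 2 (sectorMeasure D), ∀ v,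
      T v =ᵐ[sectorMeasure D] fun x => m x * value v x := by
  have hmem : ∀ v : H10 D, MemLp (fun x => m x * value v x) 2 (sectorMeasure D) := fun v =>
    ⟨hm.mul (Lp.aestronglyMeasurable v.1.fst), (hmC v).trans_lt
      (ENNReal.mul_lt_top ENNReal.ofReal_lt_top enorm_lt_top)⟩
  let T : H10 D →ₗ[ℝ] Lp ℝ 2 (sectorMeasure D) :=
    { toFun := fun v => (hmem v).toLp _
      map_add' := fun u v => by
        rw [← MemLp.toLp_add, MemLp.toLp_eq_toLp_iff]
        filter_upwards [Lp.coeFn_add u.1.fst v.1.fst] with x hx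
        have hx' : value (u + v) x = value u x + value v x := hx
        simp only [hx', Pi.add_apply]
        ring
      map_smul' := fun c v => by
        rw [RingHom.id_apply, ← MemLp.toLp_const_smul, MemLp.toLp_eq_toLp_iff]
        filter_upwards [Lp.coeFn_smul c v.1.fst] with x hx
        have hx' : value (c • v) x = c * value v x := hx
        simp only [hx', Pi.smul_apply, smul_eq_mul]
        ring }
  refine ⟨T.mkContinuous C fun v => ?_, fun v => (hmem v).coeFn_toLp⟩
  change ‖(hmem v).toLp _‖ ≤ _
  rw [Lp.norm_toLp]
  refine ENNReal.toReal_le_of_le_ofReal (by positivity) ((hmC v).trans_eq ?_)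
  rw [ENNReal.ofReal_mul hC, ofReal_norm]

lemma inner_eq_setIntegral {f g : Lp ℝ 2 (sectorMeasure D)} {F G : Space N → ℝ}
    (hf : f =ᵐ[sectorMeasure D] F) (hg : g =ᵐ[sectorMeasure D] G) :
    inner ℝ f g = ∫ x in sector D, F x * G x := by
  rw [L2.inner_def]
  refine integral_congr_ae ?_
  filter_upwards [hf, hg] with x h1 h2
  rw [h1, h2, real_inner_eq_re_inner, mul_comm]
  simp

/-- Multiplication by `‖x‖⁻¹` maps `H¹₀(S_D ∪ Γ₁)` to `L²(S_D)`. -/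
lemma IsSmoothDomain.exists_singular_multiplier (hN : 3 ≤ N) (hD : IsSmoothDomain D) :
    ∃ T : H10 D →L[ℝ] Lp ℝ 2 (sectorMeasure D), ∀ v,
      T v =ᵐ[sectorMeasure D] fun x => ‖x‖⁻¹ * value v x := by
  refine exists_multiplier (by fun_prop : Measurable fun x : Space N => ‖x‖⁻¹).aestronglyMeasurable
    (C := 2) (by norm_num) fun v => ?_
  rw [← ENNReal.pow_le_pow_left_iff two_ne_zero, eLpNorm_two_sq]
  calc ∫⁻ x in sector D, ‖‖x‖⁻¹ * value v x‖ₑ ^ 2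
      = ∫⁻ x in sector D, (‖x‖ₑ⁻¹ * ‖value v x‖ₑ) ^ 2 := by
        refine setLIntegral_congr_fun hD.isOpen_sector.measurableSet fun x hx => ?_
        have hx0 := (hD.mem_sector_iff.1 hx).1
        rw [enorm_mul, enorm_inv (norm_ne_zero_iff.2 hx0), enorm_norm]
    _ ≤ 4 * ‖v‖ₑ ^ 2 := hD.hardy_H10 hN v
    _ = _ := by rw [mul_pow]; norm_num

/-- The extra bound by the `L²` norm alone is what lets the potential term be absorbed in the
coercivity estimate. -/
lemma exists_potential_multiplier {a : Space N → ℝ} (ha : MemLp a ∞ (sectorMeasure D)) :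
    ∃ T : H10 D →L[ℝ] Lp ℝ 2 (sectorMeasure D), (∀ v,
      T v =ᵐ[sectorMeasure D] fun x => a x * value v x) ∧
      ∃ C : ℝ, 0 ≤ C ∧ ∀ v, ‖T v‖ ≤ C * ‖inclusion D v‖ := by
  have hbound : ∀ v : H10 D, eLpNorm (fun x => a x * value v x) 2 (sectorMeasure D) ≤
      ENNReal.ofReal (eLpNorm a ∞ (sectorMeasure D)).toReal * ‖inclusion D v‖ₑ := fun v => by
    rw [ENNReal.ofReal_toReal ha.2.ne, Lp.enorm_def]
    exact eLpNorm_smul_le_eLpNorm_top_mul_eLpNorm 2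
      (Lp.aestronglyMeasurable v.1.fst) a
  obtain ⟨T, hT⟩ := exists_multiplier ha.1
    (C := (eLpNorm a ∞ (sectorMeasure D)).toReal) ENNReal.toReal_nonneg fun v =>
    (hbound v).trans (by
      gcongr
      rw [← ofReal_norm, ← ofReal_norm]
      exact ENNReal.ofReal_le_ofReal (norm_pair_fst_le v.1))
  refine ⟨T, hT, (eLpNorm a ∞ (sectorMeasure D)).toReal, ENNReal.toReal_nonneg, fun v => ?_⟩
  rw [Lp.norm_def, eLpNorm_congr_ae (hT v)]
  refine ENNReal.toReal_le_of_le_ofReal (by positivity) ((hbound v).trans_eq ?_)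
  rw [ENNReal.ofReal_mul ENNReal.toReal_nonneg, ofReal_norm]

/-- The energy is the quadratic form of a symmetric bilinear form which is coercive up to the
`L²` norm. -/
lemma exists_energy_form {a : Space N → ℝ} (ha : MemLp a ∞ (sectorMeasure D)) :
    ∃ q : H10 D →L[ℝ] H10 D →L[ℝ] ℝ, (∀ v, q v v = energy a v) ∧ (∀ u v, q u v = q v u) ∧
      ∃ C : ℝ, 0 ≤ C ∧ ∀ v, ‖v‖ ^ 2 - C * ‖inclusion D v‖ ^ 2 ≤ q v v := by
  obtain ⟨A, hA, C, hC0, hC⟩ := exists_potential_multiplier ha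
  have hi : ∀ v : H10 D, inclusion D v =ᵐ[sectorMeasure D] value v := fun v => ae_eq_rfl
  have hAi : ∀ u v, inner ℝ (A u) (inclusion D v) =
      ∫ x in sector D, a x * value u x * value v x := fun u v =>
    inner_eq_setIntegral (hA u) (hi v)
  refine ⟨innerForm (gradOp D) (gradOp D) - innerForm A (inclusion D), fun v => ?_,
    fun u v => ?_, C + 1, by positivity, fun v => ?_⟩
  · change inner ℝ (gradOp D v) (gradOp D v) - inner ℝ (A v) (inclusion D v) = _
    have h1 : Integrable (fun x => ‖grad v x‖ ^ 2) (sectorMeasure D) := by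
      have := L2.integrable_inner (𝕜 := ℝ) (gradOp D v) (gradOp D v)
      simp only [real_inner_self_eq_norm_sq] at this
      exact this
    have h2 : Integrable (fun x => a x * value v x ^ 2) (sectorMeasure D) := by
      refine (L2.integrable_inner (𝕜 := ℝ) (A v) (inclusion D v)).congr ?_
      filter_upwards [hA v] with x hx
      rw [hx, coeFn_inclusion]
      simp
      ring
    rw [energy, integral_sub h1 h2, hAi, L2.inner_def]
    simp only [real_inner_self_eq_norm_sq, sq (value v _), mul_assoc]
    rfl
  · change inner ℝ (gradOp D u) (gradOp D v) - inner ℝ (A u) (inclusion D v) =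
      inner ℝ (gradOp D v) (gradOp D u) - inner ℝ (A v) (inclusion D u)
    rw [real_inner_comm, hAi, hAi]
    congr 2
    ext x
    ring
  -- In `C + 1`, the `C` bounds the potential and the `1` pays for the `L²` part of the `H¹` norm.
  · change _ ≤ inner ℝ (gradOp D v) (gradOp D v) - inner ℝ (A v) (inclusion D v)
    rw [real_inner_self_eq_norm_sq, norm_sq_eq]
    have h1 := real_inner_le_norm (A v) (inclusion D v)
    have h2 := mul_le_mul_of_nonneg_right (hC v) (norm_nonneg (inclusion D v))
    nlinarith

lemma exists_pairing_form_unit (D : Set (Space N)) :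
    ∃ w : H10 D →L[ℝ] H10 D →L[ℝ] ℝ, (∀ u v, w u v = pairing unitWeight u v) ∧
      (∀ u v, w u v = w v u) ∧ ∀ v, ‖inclusion D v‖ ^ 2 ≤ w v v := by
  refine ⟨innerForm (inclusion D) (inclusion D), fun u v => ?_,
    innerForm_symm _, fun v => (real_inner_self_eq_norm_sq _).ge⟩
  rw [innerForm_apply, inner_eq_setIntegral (f := inclusion D u) (g := inclusion D v)
    (F := value u) (G := value v) ae_eq_rfl ae_eq_rfl]
  simp [pairing, unitWeight]

lemma IsSmoothDomain.exists_pairing_form_singular (hN : 3 ≤ N) (hD : IsSmoothDomain D) :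
    ∃ w : H10 D →L[ℝ] H10 D →L[ℝ] ℝ, (∀ u v, w u v = pairing singularWeight u v) ∧
      (∀ u v, w u v = w v u) ∧ ∀ v, ‖inclusion D v‖ ^ 2 ≤ w v v := by
  obtain ⟨T, hT⟩ := hD.exists_singular_multiplier hN
  refine ⟨innerForm T T, fun u v => ?_, innerForm_symm _, fun v => ?_⟩
  · rw [innerForm_apply, inner_eq_setIntegral (hT u) (hT v), pairing]
    congr 1
    ext x
    rw [singularWeight, sq, mul_inv]
    ring
  · rw [innerForm_apply, real_inner_self_eq_norm_sq]
    -- The singular weight is at least `1` because the sector lies in the unit ball.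
    refine pow_le_pow_left₀ (norm_nonneg _) (Lp.norm_le_norm_of_ae_le ?_) 2
    filter_upwards [hT v, ae_restrict_mem hD.isOpen_sector.measurableSet] with x hx hxS
    obtain ⟨hx0, -, hx1⟩ := hD.mem_sector_iff.1 hxS
    rw [hx, norm_mul, norm_inv, norm_norm, coeFn_inclusion]
    exact le_mul_of_one_le_left (norm_nonneg _)
      ((one_le_inv₀ (norm_pos_iff.2 hx0)).2 hx1.le)

/-! ### Translation to the abstract setting and conclusion -/

instance : CompleteSpace (H10 D) :=
  (Submodule.isClosed_topologicalClosure _).completeSpace_coe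

lemma level_eq_eigenvalue {a wt : Space N → ℝ} {q w : H10 D →L[ℝ] H10 D →L[ℝ] ℝ}
    (hq : ∀ v, q v v = energy a v) (hw : ∀ u v, w u v = pairing wt u v) (ψ : ℕ → H10 D) (i : ℕ) :
    NegativeIndex.level q w ψ i = eigenvalue a wt ψ i := by
  simp only [NegativeIndex.level, NegativeIndex.constrained, eigenvalue, admissible, hq, hw]
  rfl

lemma isMinimizer_iff_attains {a wt : Space N → ℝ} {q w : H10 D →L[ℝ] H10 D →L[ℝ] ℝ}
    (hq : ∀ v, q v v = energy a v) (hw : ∀ u v, w u v = pairing wt u v) (ψ : ℕ → H10 D) (i : ℕ)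
    (v : H10 D) : NegativeIndex.IsMinimizer q w ψ i v ↔ Attains a wt ψ i v := by
  simp only [NegativeIndex.IsMinimizer, level_eq_eigenvalue hq hw, Attains, rayleigh,
    NegativeIndex.constrained, admissible, hq, hw]

end SphericalSector

end

open SphericalSector in
theorem proposition2p4 (N : ℕ) (hN : 3 ≤ N)
    (D : Set (SphericalSector.Space N)) (hD : SphericalSector.IsSmoothDomain D)
    (a : SphericalSector.Space N → ℝ) (ha : SphericalSector.IsRadialBounded D a)
    (ψ ψhat : ℕ → SphericalSector.H10 D)
    (hψ : SphericalSector.IsEigenfunctionSequence a ψ)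
    (hψhat : SphericalSector.IsSingularEigenfunctionSequence a ψhat) :
    {i : ℕ | SphericalSector.ordinaryEigenvalue a ψ i < 0}.encard =
      {i : ℕ | SphericalSector.singularEigenvalue a ψhat i < 0}.encard := by
  obtain ⟨q, hq, hqs, hqC⟩ := SphericalSector.exists_energy_form ha.memLp
  obtain ⟨w, hw, hws, hwJ⟩ := exists_pairing_form_unit D
  obtain ⟨w', hw', hws', hwJ'⟩ := hD.exists_pairing_form_singular hN
  have h : NegativeIndex.Admissible (inclusion D) q w :=
    ⟨hqs, hws, hqC, hwJ, hD.inclusion_compact hN⟩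
  have h' : NegativeIndex.Admissible (inclusion D) q w' :=
    ⟨hqs, hws', hqC, hwJ', hD.inclusion_compact hN⟩
  congr 1
  ext i
  simp only [Set.mem_ofPred_eq, ordinaryEigenvalue, singularEigenvalue,
    ← level_eq_eigenvalue hq hw, ← level_eq_eigenvalue hq hw']
  constructor
  · refine h.level_neg_transfer h' fun j _ hj => ?_
    simp only [isMinimizer_iff_attains hq hw] at hj ⊢
    exact hψ j hj
  -- The singular iteration is specified only at negative levels, so `hj0` is needed here.
  · refine h'.level_neg_transfer h fun j hj0 hj => ?_
    simp only [isMinimizer_iff_attains hq hw'] at hj ⊢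
    rw [level_eq_eigenvalue hq hw'] at hj0
    exact hψhat j hj0 hj
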